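/- **Model.** Fix $K\ge 2$, weights $w_1,\dots,w_K>0$ with $\sum_s w_s=1$, and $d\ge 1$. A data-generating distribution $\mathbb P$ is a law of $(\mathbf X,V,S,Y)\in\mathbb R^d\times[0,1]\times[K]\times\mathbb R$ such that $V\sim\mathrm{Unif}[0,1]$ is independent of $S$, $\mathbb P(S=s)=w_s$, $\mathbf X$ is drawn from a conditional law $\mathrm{Law}(\mathbf X\mid V,S)$, $Y$ is integrable and drawn from a conditional law $\mathrm{Law}(Y\mid \mathbf X)$ (causal graph $V\to \mathbf X\leftarrow S$, $\mathbf X\to Y$), and there is a measurable map $\psi$ with $V=\psi(\mathbf X,S)$ (almost surely given $V=v,S=s$, for all $(v,s)$). Let $f^*(\mathbf X,S)=\mathbb E[Y\mid \mathbf X,S]$. For a measurable predictor $f:\mathbb R^d\times[K]\to\mathbb R$ let $\mu_{f\mid v,s}=\mathrm{Law}(f(\mathbf X,S)\mid V=v,S=s)$, with c.d.f. $F_{f\mid v,s}$. $f$ is *counterfactually fair* (CF) if for all $s,s'\in[K]$ and $\mathbf x\in\mathbb R^d$, with $v=\psi(\mathbf x,s)$, the law of $f(\mathbf X',s)$ for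 $\mathbf X'\sim\mathrm{Law}(\mathbf X\mid V=v,S=s)$ equals the law of $f(\mathbf X',s')$ for $\mathbf X'\sim\mathrm{Law}(\mathbf X\mid V=v,S=s')$. The *optimal CF-fair predictor* $f_0^*$ is a minimizer of the excess risk $$\mathcal R(f)=\int_0^1\sum_{s=1}^K w_s\,\mathbb E\big[(f(\mathbf X,S)-f^*(\mathbf X,S))^2\mid V=v,S=s\big]\,dv$$ over all measurable CF predictors $f$. For $M,L_{cdf}>0$ let $\mathcal P(M,L_{cdf})$ be the class of all such $\mathbb P$ for which, for all $v\in[0,1]$ and $s\in[K]$, $\mu_{f^*\mid v,s}$ is non-atomic and supported in $[-M,M]$, and, for all $s\in[K]$ and $t\in\mathbb R$, the map $v\mapsto F_{f^*\mid v,s}(t)$ is $L_{cdf}$-Lipschitz on $[0,1]$. An *estimator* $\hat f_n$ maps $n$ i.i.d. observations $(\mathbf X_i,V_i,S_i,Y_i)$ from $\mathbb P$ (jointly measurably in the sample and the point) to a predictor; it may also make use of $\psi$ and of $f^*$, but is otherwise not allowed to depend on $\mathbb P$. **Theorem.** For all $M,L_{cdf}>0$, $K\ge2$ and weights $(w_s)_s$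 as above there is a constant $C_{MSE}>0$, depending only on $M$, $L_{cdf}$ and $(w_s)_s$, such that for all $d\ge1$ and $n\ge 1$ $$\inf_{\hat f_n}\ \sup_{\mathbb P\in\mathcal P(M,L_{cdf})}\ \mathbb E\big[\|\hat f_n-f_0^*\|^2\big]\ \ge\ C_{MSE}\,n^{-1/3},$$ where $\|\cdot\|$ is the norm of $L^2$ of the law of $(\mathbf X,S)$ under $\mathbb P$ and the supremum is over the members of the class (with the $\psi$, $f^*$, $f_0^*$ belonging to them). -/

import Mathlib

open MeasureTheory ProbabilityTheory

noncomputable section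

namespace FairRegression

/-- The feature space `ℝ^d`. -/
abbrev Features (d : ℕ) : Type := EuclideanSpace ℝ (Fin d)

/-- One full observation `(((V, S), X), Y)`: exogenous variable `V ∈ [0,1]`, sensitive attribute
`S ∈ [K]`, features `X ∈ ℝ^d`, outcome `Y ∈ ℝ`. -/
abbrev Obs (d K : ℕ) : Type := ((unitInterval × Fin K) × Features d) × ℝ

/-- The pair `(X, S)` extracted from an observation. -/
def predictorInput {d K : ℕ} (o : Obs d K) : Features d × Fin K := (o.1.2, o.1.1.2)

/-- The law of `S`: `P(S = s) = w s`. -/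
def groupLaw {K : ℕ} (w : Fin K → ℝ) : Measure (Fin K) :=
  Measure.sum fun s => ENNReal.ofReal (w s) • Measure.dirac s

/-- The joint law of `(((V, S), X), Y)` in the structural causal model `V → X ← S`, `X → Y`:
`V` is uniform on `[0,1]` and independent of `S ∼ w`, `X` is drawn from `κ (V, S)`, and `Y` is
drawn from `ρ X`. -/
def jointLaw {d K : ℕ} (w : Fin K → ℝ) (κ : Kernel (unitInterval × Fin K) (Features d))
    (ρ : Kernel (Features d) ℝ) : Measure (Obs d K) :=
  (((volume : Measure unitInterval).prod (groupLaw w)) ⊗ₘ κ) ⊗ₘ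
    (Kernel.prodMkLeft (unitInterval × Fin K) ρ)

/-- A data-generating distribution with group weights `w`, given by the conditional laws of the
causal model, together with the abduction map `ψ` and the Bayes predictor `f^*` that belong to
it. -/
structure CausalModel (d K : ℕ) (w : Fin K → ℝ) where
  /-- `κ (v, s) = Law(X | V = v, S = s)`. -/
  featureLaw : Kernel (unitInterval × Fin K) (Features d)
  isMarkov_featureLaw : IsMarkovKernel featureLaw
  /-- `ρ x = Law(Y | X = x)`. -/
  outcomeLaw : Kernel (Features d) ℝ
  isMarkov_outcomeLaw : IsMarkovKernel outcomeLaw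
  integrable_outcome : Integrable (fun o : Obs d K => o.2) (jointLaw w featureLaw outcomeLaw)
  /-- The map `ψ` that recovers `V` from `(X, S)`. -/
  abduct : Features d × Fin K → unitInterval
  measurable_abduct : Measurable abduct
  abduct_eq : ∀ (v : unitInterval) (s : Fin K), ∀ᵐ x ∂(featureLaw (v, s)), abduct (x, s) = v
  /-- The Bayes predictor `f^*`: a version of `E[Y | X, S]`, as a function of `(x, s)`. -/
  bayes : Features d × Fin K → ℝ
  measurable_bayes : Measurable bayes
  bayes_ae_eq :
    (fun o : Obs d K => bayes (predictorInput o)) =ᵐ[jointLaw w featureLaw outcomeLaw]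
      (jointLaw w featureLaw outcomeLaw)[(fun o : Obs d K => o.2) |
        MeasurableSpace.comap (predictorInput (d := d) (K := K)) inferInstance]

namespace CausalModel

variable {d K : ℕ} {w : Fin K → ℝ}

/-- The law of one observation. -/
def law (P : CausalModel d K w) : Measure (Obs d K) :=
  jointLaw w P.featureLaw P.outcomeLaw

/-- `μ_{f | v, s}`, the law of `f(X, S)` given `V = v`, `S = s`. -/
def predLaw (P : CausalModel d K w) (f : Features d × Fin K → ℝ) (v : unitInterval)
    (s : Fin K) : Measure ℝ :=
  (P.featureLaw (v, s)).map fun x => f (x, s)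

/-- `f` has non-atomic conditional prediction laws, supported in `[-M, M]`. -/
def BoundedNonatomic (P : CausalModel d K w) (f : Features d × Fin K → ℝ) (M : ℝ) : Prop :=
  ∀ (v : unitInterval) (s : Fin K),
    NullSingletonClass (P.predLaw f v s) ∧ P.predLaw f v s (Set.Icc (-M) M)ᶜ = 0

/-- The conditional c.d.f.s `v ↦ F_{f | v, s}(t)` are `L`-Lipschitz. -/
def LipschitzCdf (P : CausalModel d K w) (f : Features d × Fin K → ℝ) (L : ℝ) : Prop :=
  ∀ (s : Fin K) (t : ℝ) (v v' : unitInterval),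
    |cdf (P.predLaw f v s) t - cdf (P.predLaw f v' s) t| ≤ L * |(v : ℝ) - (v' : ℝ)|

/-- The class `𝒫(M, L)`: the Bayes predictor satisfies the two regularity properties. -/
def InClass (P : CausalModel d K w) (M L : ℝ) : Prop :=
  P.BoundedNonatomic P.bayes M ∧ P.LipschitzCdf P.bayes L

/-- The law of the counterfactual prediction `Ŷ_{S ← s'}` given `X = x`, `S = s`, with re-sampled
noise: recover `v = ψ(x, s)`, draw `X'` from `Law(X | V = v, S = s')`, output `f(X', s')`. -/
def counterfactualLaw (P : CausalModel d K w) (f : Features d × Fin K → ℝ) (x : Features d)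
    (s s' : Fin K) : Measure ℝ :=
  (P.featureLaw (P.abduct (x, s), s')).map fun x' => f (x', s')

/-- Counterfactual fairness of the predictor `f`. -/
def IsCF (P : CausalModel d K w) (f : Features d × Fin K → ℝ) : Prop :=
  ∀ (s s' : Fin K) (x : Features d),
    P.counterfactualLaw f x s s = P.counterfactualLaw f x s s'

/-- The conditional excess risk `ℛ_v(f)`. -/
def riskAt (P : CausalModel d K w) (f : Features d × Fin K → ℝ) (v : unitInterval) : ENNReal :=
  ∑ s, ENNReal.ofReal (w s) *
    ∫⁻ x, ENNReal.ofReal ((f (x, s) - P.bayes (x, s)) ^ 2) ∂(P.featureLaw (v, s))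

/-- The excess risk `ℛ(f) = ∫ ℛ_v(f) dv`. -/
def risk (P : CausalModel d K w) (f : Features d × Fin K → ℝ) : ENNReal :=
  ∫⁻ v, P.riskAt f v

/-- `f₀` is an optimal fair predictor: it minimizes the excess risk among all (measurable)
counterfactually fair predictors. Such an `f₀` is unique up to almost sure equality when `f^*` has
non-atomic, uniformly bounded conditional laws. -/
def IsOptimalFair (P : CausalModel d K w) (f₀ : Features d × Fin K → ℝ) : Prop :=
  (Measurable f₀ ∧ P.IsCF f₀) ∧
    ∀ g : Features d × Fin K → ℝ, Measurable g → P.IsCF g → P.risk f₀ ≤ P.risk g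

end CausalModel

/-- An estimator based on `n` observations. It sees full observations, and may moreover use the
abduction map `ψ` (first argument) and the Bayes predictor `f^*` (second argument), as a
post-processing method given a perfect black box does. Ignoring these arguments or parts of the
observations is allowed, so that every estimator based on less information is included. -/
structure Estimator (d K n : ℕ) where
  toFun : (Features d × Fin K → unitInterval) → (Features d × Fin K → ℝ) →
    (Fin n → Obs d K) → Features d × Fin K → ℝ
  measurable_toFun : ∀ (ψ : Features d × Fin K → unitInterval) (fstar : Features d × Fin K → ℝ),
    Measurable fun q : (Fin n → Obs d K) × (Features d × Fin K) => toFun ψ fstar q.1 q.2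

/-- The mean squared error `E ‖f̂_n - f₀‖²`, where the expectation is over an i.i.d. sample of size
`n` from `P` and the norm is that of `L²` of the law of `(X, S)` under `P`. -/
def meanSquaredError {d K n : ℕ} {w : Fin K → ℝ} (P : CausalModel d K w) (est : Estimator d K n)
    (f₀ : Features d × Fin K → ℝ) : ENNReal :=
  ∫⁻ D, ∫⁻ o, ENNReal.ofReal
      ((est.toFun P.abduct P.bayes D (predictorInput o) - f₀ (predictorInput o)) ^ 2) ∂P.law
    ∂(Measure.pi fun _ : Fin n => P.law)

end FairRegression

end

/-! The bound comes from a finite family of models in which the optimal fair predictor moves much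
while the data hardly change. In one group `s₀` the Bayes prediction has two clusters, `[-M, -M/2)`
and `[M/2, M)`, of equal mass; in all other groups it is uniform on `[0, M)`. Given `V = v`, a mass
`b v` is moved from the upper cluster to the lower one. The optimal fair predictor is a Wasserstein
barycenter: it averages the quantile functions of the groups. Levels between `1/2` and `1/2 + b v`
belong to the upper cluster before the move and to the lower one after it, so there the predictor
changes by at least `w s₀ * M` (`latentFair_gap`). The squared loss is thus of order `b`, whereas
the second moment of the likelihood ratio changes only by order `b ^ 2`.

Cut `[0, 1]` into bins of width `1 / m` and switch a bump of height `c / m` on or off in each; the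
Lipschitz condition allows this height. A single bump changes the second moment for one observation
by `O(m⁻³)`, so `n ≤ m ^ 3` observations do not reveal it (`one_add_pow_le`, `two_point_bound_pi`).
Averaging over all on/off patterns, as in Assouad's lemma, the error is at least of the order of the
mass of the affected levels, `1 / m` (`le_of_forall_meanSquaredError_le`); `m ≈ n^(1/3)` gives the
rate. All models share `ψ` and `f^*`, so knowing these does not help.

That the barycenter is optimal is proved by duality (`isOptimalFair_of_potentials`): it suffices to
have convex potentials with weighted average `z ^ 2 / 2` whose subgradients at the fair prediction
contain the Bayes prediction (`exists_barycenter_potentials`). -/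

/-! ### Convex potentials for the barycenter of two laws on the line. -/

/-- The primitive of a monotone function satisfies the subgradient inequality. -/
theorem Monotone.integral_subgradient {p : ℝ → ℝ} (hp : Monotone p) (a z : ℝ) :
    (∫ x in (0 : ℝ)..a, p x) + p a * (z - a) ≤ ∫ x in (0 : ℝ)..z, p x := by
  have hi : ∀ x y : ℝ, IntervalIntegrable p volume x y := fun x y => hp.intervalIntegrable
  have h : (∫ x in (0 : ℝ)..z, p x) - ∫ x in (0 : ℝ)..a, p x = ∫ x in a..z, p x :=
    intervalIntegral.integral_interval_sub_left (hi _ _) (hi _ _)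
  have hc : ∫ _ in a..z, p a = p a * (z - a) := by simp [mul_comm]
  rcases le_total a z with haz | haz
  · have := intervalIntegral.integral_mono_on haz (intervalIntegrable_const (c := p a)) (hi a z)
      (fun x hx => hp hx.1)
    linarith
  · have := intervalIntegral.integral_mono_on haz (hi z a) (intervalIntegrable_const (c := p a))
      (fun x hx => hp hx.2)
    rw [intervalIntegral.integral_symm z a] at h
    have hc' : ∫ _ in z..a, p a = p a * (a - z) := by simp [mul_comm]
    linarith

/-- The inverse of `α T + β id`, for monotone `T`, is monotone with a monotone defect. -/
theorem exists_monotone_inverse {α β : ℝ} (hα : 0 < α) (hβ : 0 < β) {T : ℝ → ℝ}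
    (hT : Monotone T) :
    ∃ q : ℝ → ℝ, Monotone q ∧ (∀ u, q (α * T u + β * u) = u) ∧
      Monotone fun z => z - β * q z := by
  have key : ∀ u u', u ≤ u' → α * T u + β * u + β * (u' - u) ≤ α * T u' + β * u' := by
    intro u u' h
    nlinarith [hT h]
  have hne : ∀ z, {u | α * T u + β * u ≤ z}.Nonempty := by
    intro z
    refine ⟨min 0 ((z - α * T 0) / β), ?_⟩
    have h1 := key _ 0 (min_le_left 0 ((z - α * T 0) / β))
    have h2 : min 0 ((z - α * T 0) / β) ≤ (z - α * T 0) / β := min_le_right _ _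
    rw [le_div_iff₀ hβ] at h2
    simp only [Set.mem_ofPred_eq]
    linarith
  have hbd : ∀ z, BddAbove {u | α * T u + β * u ≤ z} := by
    intro z
    refine ⟨max 0 ((z - α * T 0) / β), fun u hu => ?_⟩
    simp only [Set.mem_ofPred_eq] at hu
    rcases le_total u 0 with h | h
    · exact h.trans (le_max_left _ _)
    · refine le_trans ?_ (le_max_right _ _)
      rw [le_div_iff₀ hβ]
      have := key 0 u h
      linarith
  refine ⟨fun z => sSup {u | α * T u + β * u ≤ z}, ?_, ?_, ?_⟩
  · intro z z' hz
    exact csSup_le_csSup (hbd z') (hne z) fun u (hu : _ ≤ z) => le_trans hu hz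
  · intro u
    refine le_antisymm (csSup_le (hne _) fun x hx => ?_) (le_csSup (hbd _) ?_)
    swap; · exact le_refl (α * T u + β * u)
    by_contra! hlt
    have := key u x hlt.le
    simp only [Set.mem_ofPred_eq] at hx
    nlinarith
  · intro z z' hz
    -- `α T + β id` has slope at least `β`, so `q` is `1 / β`-Lipschitz; this makes the defect
    -- monotone.
    have : sSup {u | α * T u + β * u ≤ z'} ≤ sSup {u | α * T u + β * u ≤ z} + (z' - z) / β := by
      refine csSup_le (hne z') fun u hu => ?_
      rw [← sub_le_iff_le_add]
      refine le_csSup (hbd z) ?_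
      have hd : 0 ≤ (z' - z) / β := div_nonneg (by linarith) hβ.le
      have h1 := key (u - (z' - z) / β) u (by linarith)
      have h2 : β * ((z' - z) / β) = z' - z := by field_simp
      simp only [Set.mem_ofPred_eq] at hu ⊢
      have h3 : β * (u - (u - (z' - z) / β)) = z' - z := by
        rw [sub_sub_cancel, h2]
      linarith
    have h2 : β * ((z' - z) / β) = z' - z := by field_simp
    have := mul_le_mul_of_nonneg_left this hβ.le
    simp only
    linarith

/-- Convex potentials of the weighted barycenter of two quantile functions `T` and `id`. -/
theorem exists_barycenter_potentials {α β : ℝ} (hα : 0 < α) (hβ : 0 < β) {T : ℝ → ℝ}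
    (hT : Monotone T) :
    ∃ φ ψ : ℝ → ℝ, Continuous φ ∧ Continuous ψ ∧
      (∃ C, ∀ z, |φ z| ≤ C * (1 + z ^ 2) ∧ |ψ z| ≤ C * (1 + z ^ 2)) ∧
      (∀ z, α * φ z + β * ψ z = z ^ 2 / 2) ∧
      (∀ u z, φ (α * T u + β * u) + T u * (z - (α * T u + β * u)) ≤ φ z) ∧
      (∀ u z, ψ (α * T u + β * u) + u * (z - (α * T u + β * u)) ≤ ψ z) := by
  obtain ⟨q, hq, hinv, hdef⟩ := exists_monotone_inverse hα hβ hT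
  -- `p` and `q` recover the two quantile values from their weighted average. Both are monotone, so
  -- their primitives are convex.
  set p : ℝ → ℝ := fun z => (z - β * q z) / α with hpdef
  have hp : Monotone p := fun z z' h => div_le_div_of_nonneg_right (hdef h) hα.le
  have hpq : ∀ z, α * p z + β * q z = z := by
    intro z; simp only [hpdef]; field_simp; ring
  have hpi : ∀ x y : ℝ, IntervalIntegrable p volume x y := fun x y => hp.intervalIntegrable
  have hqi : ∀ x y : ℝ, IntervalIntegrable q volume x y := fun x y => hq.intervalIntegrable
  have hsum : ∀ z, α * (∫ x in (0 : ℝ)..z, p x) + β * (∫ x in (0 : ℝ)..z, q x) = z ^ 2 / 2 := by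
    intro z
    rw [← intervalIntegral.integral_const_mul, ← intervalIntegral.integral_const_mul,
      ← intervalIntegral.integral_add ((hpi _ _).const_mul α) ((hqi _ _).const_mul β)]
    simp [hpq]
  have hp0 : ∀ z, p 0 * z ≤ ∫ x in (0 : ℝ)..z, p x := fun z => by
    simpa using hp.integral_subgradient 0 z
  have hq0 : ∀ z, q 0 * z ≤ ∫ x in (0 : ℝ)..z, q x := fun z => by
    simpa using hq.integral_subgradient 0 z
  have habs : ∀ c z : ℝ, |c * z| ≤ |c| * (1 + z ^ 2) := fun c z => by
    rw [abs_mul]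
    refine mul_le_mul_of_nonneg_left ?_ (abs_nonneg c)
    nlinarith [sq_abs z, sq_nonneg (|z| - 1)]
  refine ⟨fun z => ∫ x in (0 : ℝ)..z, p x, fun z => ∫ x in (0 : ℝ)..z, q x,
    intervalIntegral.continuous_primitive hpi 0, intervalIntegral.continuous_primitive hqi 0,
    ⟨(1 / 2 + β * |q 0|) / α + (1 / 2 + α * |p 0|) / β + |p 0| + |q 0|, fun z => ?_⟩, hsum, ?_, ?_⟩
  · have h1 := hp0 z
    have h2 := hq0 z
    have h3 := hsum z
    have e1 := abs_le.1 (habs (p 0) z)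
    have e2 := abs_le.1 (habs (q 0) z)
    have hz : (0 : ℝ) ≤ 1 + z ^ 2 := by positivity
    -- The tangents at `0` give linear lower bounds. Since the potentials average to `z ^ 2 / 2`, a
    -- lower bound on one is an upper bound on the other.
    have k1 : (∫ x in (0 : ℝ)..z, p x) ≤ (1 / 2 + β * |q 0|) / α * (1 + z ^ 2) := by
      rw [div_mul_eq_mul_div, le_div_iff₀ hα]
      nlinarith [mul_le_mul_of_nonneg_left h2 hβ.le]
    have k2 : (∫ x in (0 : ℝ)..z, q x) ≤ (1 / 2 + α * |p 0|) / β * (1 + z ^ 2) := by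
      rw [div_mul_eq_mul_div, le_div_iff₀ hβ]
      nlinarith [mul_le_mul_of_nonneg_left h1 hα.le]
    have n1 : 0 ≤ (1 / 2 + β * |q 0|) / α * (1 + z ^ 2) := by positivity
    have n2 : 0 ≤ (1 / 2 + α * |p 0|) / β * (1 + z ^ 2) := by positivity
    have n3 : 0 ≤ |p 0| * (1 + z ^ 2) := by positivity
    have n4 : 0 ≤ |q 0| * (1 + z ^ 2) := by positivity
    constructor <;> rw [abs_le] <;> constructor <;> linarith
  · intro u z
    have h := hp.integral_subgradient (α * T u + β * u) z
    have : p (α * T u + β * u) = T u := by simp only [hpdef, hinv]; field_simp; ring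
    rwa [this] at h
  · intro u z
    have h := hq.integral_subgradient (α * T u + β * u) z
    rwa [hinv] at h

/-! ### A duality criterion for optimal fair predictors. -/

namespace FairRegression.CausalModel

variable {d K : ℕ} {w : Fin K → ℝ}

instance (P : CausalModel d K w) : IsMarkovKernel P.featureLaw := P.isMarkov_featureLaw

instance (P : CausalModel d K w) : IsMarkovKernel P.outcomeLaw := P.isMarkov_outcomeLaw

/-- Every value of `V` is recovered from some feature vector. -/
theorem exists_abduct_eq (P : CausalModel d K w) (v : unitInterval) (s : Fin K) :
    ∃ x, P.abduct (x, s) = v :=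
  (P.abduct_eq v s).exists

/-- Fairness is stated at feature vectors; as `ψ(·, s)` attains every `v`, it passes to all
conditional laws. -/
theorem IsCF.predLaw_eq {P : CausalModel d K w} {f : Features d × Fin K → ℝ} (hf : P.IsCF f)
    (v : unitInterval) (s s' : Fin K) : P.predLaw f v s = P.predLaw f v s' := by
  obtain ⟨x, hx⟩ := P.exists_abduct_eq v s
  have := hf s s' x
  rwa [counterfactualLaw, counterfactualLaw, hx] at this

/-- For a counterfactually fair `f` and functions `φ s` of quadratic growth that average to half
the square, the defects `z ^ 2 - 2 φ s z` average to zero along the predictions. -/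
theorem IsCF.sum_integral_defect_eq_zero {P : CausalModel d K w} {f : Features d × Fin K → ℝ}
    (hf : P.IsCF f) (hfm : Measurable f) (hw1 : ∑ s, w s = 1) {v : unitInterval}
    {φ : Fin K → ℝ → ℝ} (hφ : ∀ s, Continuous (φ s)) (hsum : ∀ z, ∑ s, w s * φ s z = z ^ 2 / 2)
    (hint : ∀ s s', Integrable (fun x => (f (x, s)) ^ 2 - 2 * φ s' (f (x, s)))
      (P.featureLaw (v, s))) :
    ∑ s, w s * ∫ x, ((f (x, s)) ^ 2 - 2 * φ s (f (x, s))) ∂(P.featureLaw (v, s)) = 0 := by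
  obtain ⟨s₀⟩ : Nonempty (Fin K) := by
    by_contra h
    rw [not_nonempty_iff] at h
    simp at hw1
  have hmeas : ∀ s, Measurable fun x => f (x, s) := fun s => by fun_prop
  have hcont : ∀ s, Continuous fun z : ℝ => z ^ 2 - 2 * φ s z := fun s => by
    have := hφ s
    fun_prop
  -- By fairness the prediction has one law for all groups, so the weighted sum can be taken inside
  -- a single integral.
  have key : ∀ s, ∫ x, ((f (x, s)) ^ 2 - 2 * φ s (f (x, s))) ∂(P.featureLaw (v, s))
      = ∫ z, (z ^ 2 - 2 * φ s z) ∂(P.predLaw f v s₀) := by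
    intro s
    rw [hf.predLaw_eq v s₀ s, predLaw,
      integral_map (hmeas s).aemeasurable (hcont s).aestronglyMeasurable]
  have hint' : ∀ s, Integrable (fun z => z ^ 2 - 2 * φ s z) (P.predLaw f v s₀) := by
    intro s
    rw [predLaw, integrable_map_measure (hcont s).aestronglyMeasurable (hmeas s₀).aemeasurable]
    exact hint s₀ s
  simp_rw [key, ← integral_const_mul]
  rw [← integral_finsetSum _ fun s _ => (hint' s).const_mul (w s)]
  have : ∀ z : ℝ, ∑ s, w s * (z ^ 2 - 2 * φ s z) = 0 := by
    intro z
    have e : ∑ s, w s * (z ^ 2 - 2 * φ s z) = (∑ s, w s) * z ^ 2 - 2 * ∑ s, w s * φ s z := by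
      rw [Finset.sum_mul, Finset.mul_sum, ← Finset.sum_sub_distrib]
      exact Finset.sum_congr rfl fun s _ => by ring
    rw [e, hw1, hsum]; ring
  simp [this]

/-- A counterfactually fair predictor whose predictions have the Bayes predictions as subgradients
of potentials that average to half the square is an optimal fair predictor. -/
theorem isOptimalFair_of_potentials (P : CausalModel d K w) (hw : ∀ s, 0 < w s)
    (hw1 : ∑ s, w s = 1) {f₀ : Features d × Fin K → ℝ} (hm : Measurable f₀) (hf₀ : P.IsCF f₀)
    {B : ℝ} (hB : ∀ v s, ∀ᵐ x ∂(P.featureLaw (v, s)), |P.bayes (x, s)| ≤ B)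
    (hB₀ : ∀ v s, ∀ᵐ x ∂(P.featureLaw (v, s)), |f₀ (x, s)| ≤ B)
    (hpot : ∀ v : unitInterval, ∃ φ : Fin K → ℝ → ℝ, (∀ s, Continuous (φ s)) ∧
      (∃ C, ∀ s z, |φ s z| ≤ C * (1 + z ^ 2)) ∧ (∀ z, ∑ s, w s * φ s z = z ^ 2 / 2) ∧
      ∀ s, ∀ᵐ x ∂(P.featureLaw (v, s)), ∀ z,
        φ s (f₀ (x, s)) + P.bayes (x, s) * (z - f₀ (x, s)) ≤ φ s z) :
    P.IsOptimalFair f₀ := by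
  -- The risks are compared separately for each `v`.
  refine ⟨⟨hm, hf₀⟩, fun g hg hgCF => lintegral_mono fun v => ?_⟩
  obtain ⟨φ, hφ, ⟨C, hC⟩, hsum, hsub⟩ := hpot v
  by_cases htop : P.riskAt g v = ⊤
  · rw [htop]; exact le_top
  have hym := P.measurable_bayes
  have hgi : ∀ s, Integrable (fun x => (g (x, s) - P.bayes (x, s)) ^ 2) (P.featureLaw (v, s)) := by
    intro s
    have hlt : ∫⁻ x, ENNReal.ofReal ((g (x, s) - P.bayes (x, s)) ^ 2) ∂(P.featureLaw (v, s)) < ⊤ := by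
      rw [lt_top_iff_ne_top]
      intro h
      refine htop ?_
      rw [riskAt, ENNReal.sum_eq_top]
      exact ⟨s, Finset.mem_univ s, by
        rw [h]; exact ENNReal.mul_top (by simpa using hw s)⟩
    refine ⟨by fun_prop, ?_⟩
    rwa [hasFiniteIntegral_iff_ofReal (ae_of_all _ fun x => sq_nonneg _)]
  have hbd : ∀ s, ∀ h : Features d × Fin K → ℝ, Measurable h →
      (∀ᵐ x ∂(P.featureLaw (v, s)), |h (x, s)| ≤ B) →
      Integrable (fun x => (h (x, s)) ^ 2) (P.featureLaw (v, s)) := by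
    intro s h hh hb
    have : Measurable fun x => (h (x, s)) ^ 2 := by fun_prop
    refine Integrable.of_bound this.aestronglyMeasurable (B ^ 2) ?_
    filter_upwards [hb] with x hx
    rw [Real.norm_eq_abs, abs_of_nonneg (sq_nonneg _), ← sq_abs]
    exact pow_le_pow_left₀ (abs_nonneg _) hx 2
  have hysq := fun s => hbd s _ hym (hB v s)
  have hf₀sq := fun s => hbd s _ hm (hB₀ v s)
  have hgsq : ∀ s, Integrable (fun x => (g (x, s)) ^ 2) (P.featureLaw (v, s)) := by
    intro s
    have : Measurable fun x => (g (x, s)) ^ 2 := by fun_prop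
    refine (((hgi s).const_mul 2).add ((hysq s).const_mul 2)).mono' this.aestronglyMeasurable ?_
    refine ae_of_all _ fun x => ?_
    rw [Real.norm_eq_abs, abs_of_nonneg (sq_nonneg _)]
    simp only [Pi.add_apply]
    nlinarith [sq_nonneg (g (x, s) - 2 * P.bayes (x, s))]
  have hfi : ∀ s, Integrable (fun x => (f₀ (x, s) - P.bayes (x, s)) ^ 2)
      (P.featureLaw (v, s)) := by
    intro s
    refine (((hf₀sq s).const_mul 2).add ((hysq s).const_mul 2)).mono' (by fun_prop) ?_
    refine ae_of_all _ fun x => ?_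
    rw [Real.norm_eq_abs, abs_of_nonneg (sq_nonneg _)]
    simp only [Pi.add_apply]
    nlinarith [sq_nonneg (f₀ (x, s) + P.bayes (x, s))]
  have hdef : ∀ h : Features d × Fin K → ℝ, Measurable h →
      (∀ s, Integrable (fun x => (h (x, s)) ^ 2) (P.featureLaw (v, s))) → ∀ s s',
      Integrable (fun x => (h (x, s)) ^ 2 - 2 * φ s' (h (x, s))) (P.featureLaw (v, s)) := by
    intro h hh hsq s s'
    refine (hsq s).sub (Integrable.const_mul ?_ 2)
    have hφm := (hφ s').measurable
    have : Measurable fun x => φ s' (h (x, s)) := by fun_prop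
    refine (((integrable_const 1).add (hsq s)).const_mul C).mono' this.aestronglyMeasurable ?_
    exact ae_of_all _ fun x => hC s' (h (x, s))
  have hrisk : ∀ h : Features d × Fin K → ℝ,
      (∀ s, Integrable (fun x => (h (x, s) - P.bayes (x, s)) ^ 2) (P.featureLaw (v, s))) →
      P.riskAt h v = ENNReal.ofReal
        (∑ s, w s * ∫ x, (h (x, s) - P.bayes (x, s)) ^ 2 ∂(P.featureLaw (v, s))) := by
    intro h hi
    rw [riskAt, ENNReal.ofReal_sum_of_nonneg fun s _ =>
      mul_nonneg (hw s).le (integral_nonneg fun x => sq_nonneg _)]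
    refine Finset.sum_congr rfl fun s _ => ?_
    rw [ENNReal.ofReal_mul (hw s).le,
      ofReal_integral_eq_lintegral_ofReal (hi s) (ae_of_all _ fun x => sq_nonneg _)]
  rw [hrisk g hgi, hrisk f₀ hfi]
  refine ENNReal.ofReal_le_ofReal ?_
  have hz := hgCF.sum_integral_defect_eq_zero hg hw1 hφ hsum (hdef g hg hgsq)
  have hz₀ := hf₀.sum_integral_defect_eq_zero hm hw1 hφ hsum (hdef f₀ hm hf₀sq)
  -- After expanding the squares, the integrands differ by twice the subgradient inequality at `z =
  -- g (x, s)`. The defect terms vanish in the weighted sum by `hz` and `hz₀`.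
  have hle : ∀ s, (∫ x, (f₀ (x, s) - P.bayes (x, s)) ^ 2 ∂(P.featureLaw (v, s))) +
      ∫ x, ((g (x, s)) ^ 2 - 2 * φ s (g (x, s))) ∂(P.featureLaw (v, s)) ≤
      (∫ x, (g (x, s) - P.bayes (x, s)) ^ 2 ∂(P.featureLaw (v, s))) +
      ∫ x, ((f₀ (x, s)) ^ 2 - 2 * φ s (f₀ (x, s))) ∂(P.featureLaw (v, s)) := by
    intro s
    rw [← integral_add (hfi s) (hdef g hg hgsq s s), ← integral_add (hgi s) (hdef f₀ hm hf₀sq s s)]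
    refine integral_mono_ae ((hfi s).add (hdef g hg hgsq s s))
      ((hgi s).add (hdef f₀ hm hf₀sq s s)) ?_
    filter_upwards [hsub s] with x hx
    have := hx (g (x, s))
    nlinarith
  have := Finset.sum_le_sum fun s (_ : s ∈ Finset.univ) =>
    mul_le_mul_of_nonneg_left (hle s) (hw s).le
  simp only [mul_add, Finset.sum_add_distrib] at this
  linarith

end FairRegression.CausalModel

/-! ### Two-point lower bounds through the second moment of the likelihood ratio. -/

namespace MeasureTheory

variable {α : Type*} [MeasurableSpace α]

theorem lintegral_pi_prod_eq_prod {n : ℕ} (μ : Measure α) [IsProbabilityMeasure μ]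
    {g : Fin n → α → ENNReal} (hg : ∀ i, Measurable (g i)) :
    ∫⁻ D, ∏ i, g i (D i) ∂(Measure.pi fun _ : Fin n => μ) = ∏ i, ∫⁻ x, g i x ∂μ := by
  have hind := iIndepFun_pi (μ := fun _ : Fin n => μ) (X := g) fun i => (hg i).aemeasurable
  have h := lintegral_prod_eq_prod_lintegral_of_indepFun Finset.univ
    (fun i (D : Fin n → α) => g i (D i)) hind (fun i => by have := hg i; fun_prop)
  rw [h]
  refine Finset.prod_congr rfl fun i _ => ?_
  exact (measurePreserving_eval (fun _ : Fin n => μ) i).lintegral_comp (hg i)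

theorem pi_withDensity_eq {n : ℕ} (μ : Measure α) [IsProbabilityMeasure μ] {G : α → ENNReal}
    (hG : Measurable G) [IsProbabilityMeasure (μ.withDensity G)] :
    (Measure.pi fun _ : Fin n => μ.withDensity G) =
      (Measure.pi fun _ : Fin n => μ).withDensity fun D => ∏ i, G (D i) := by
  refine (Measure.pi_eq fun t ht => ?_)
  have hpi : MeasurableSet (Set.univ.pi t) := MeasurableSet.univ_pi ht
  rw [withDensity_apply _ hpi, ← lintegral_indicator hpi]
  have hprod : ∀ D : Fin n → α, (Set.univ.pi t).indicator (fun D => ∏ i, G (D i)) D =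
      ∏ i, (t i).indicator G (D i) := by
    intro D
    by_cases hD : D ∈ Set.univ.pi t
    · rw [Set.indicator_of_mem hD]
      exact Finset.prod_congr rfl fun i _ => (Set.indicator_of_mem (hD i (Set.mem_univ i)) _).symm
    · rw [Set.indicator_of_notMem hD]
      simp only [Set.mem_pi, Set.mem_univ, forall_const, not_forall] at hD
      obtain ⟨i, hi⟩ := hD
      exact (Finset.prod_eq_zero (Finset.mem_univ i) (Set.indicator_of_notMem hi _)).symm
  simp_rw [hprod]
  rw [lintegral_pi_prod_eq_prod μ fun i => hG.indicator (ht i)]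
  refine Finset.prod_congr rfl fun i _ => ?_
  rw [withDensity_apply _ (ht i), lintegral_indicator (ht i)]

/-- A density whose second moment is at most `5 / 4` overlaps with `1` by at least `1 / 2`. -/
theorem half_le_lintegral_min_one {π : Measure α} [IsProbabilityMeasure π] {H : α → ENNReal}
    (hH : Measurable H) (h1 : ∫⁻ x, H x ∂π = 1) (h2 : ∫⁻ x, H x ^ 2 ∂π ≤ 5 / 4) :
    1 / 2 ≤ ∫⁻ x, min 1 (H x) ∂π := by
  -- This is `(x - 1/2) ^ 2 ≥ 0` for `x ≤ 1`, and weaker than `(x - 1) ^ 2 ≥ 0` for `x ≥ 1`.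
  -- Integrated, it reads `2 ≤ I + 5/4 + 1/4`.
  have hpt : ∀ x : ENNReal, 2 * x ≤ min 1 x + x ^ 2 + 1 / 4 := by
    intro x
    induction x with
    | top => simp
    | coe x =>
      have : 2 * x ≤ min 1 x + x ^ 2 + 1 / 4 := by
        rw [← NNReal.coe_le_coe]
        push_cast
        rcases le_total (1 : ℝ) x with h | h
        · rw [min_eq_left h]; nlinarith [sq_nonneg ((x : ℝ) - 1)]
        · rw [min_eq_right h]; nlinarith [sq_nonneg ((x : ℝ) - 1 / 2)]
      have h' := ENNReal.coe_le_coe.2 this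
      push_cast at h'
      convert h' using 2
  have hint : ∫⁻ x, 2 * H x ∂π ≤ ∫⁻ x, (min 1 (H x) + H x ^ 2 + 1 / 4) ∂π :=
    lintegral_mono fun x => hpt (H x)
  rw [lintegral_const_mul _ hH, h1, lintegral_add_right _ measurable_const,
    lintegral_add_right _ (hH.pow_const 2), lintegral_const, measure_univ] at hint
  have h3 : (2 : ENNReal) ≤ ∫⁻ x, min 1 (H x) ∂π + 5 / 4 + 1 / 4 := by
    calc (2 : ENNReal) = 2 * 1 := by norm_num
      _ ≤ _ := hint
      _ ≤ _ := by rw [mul_one]; gcongr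
  set I := ∫⁻ x, min 1 (H x) ∂π
  by_cases hI : I = ⊤
  · rw [hI]; exact le_top
  · lift I to NNReal using hI with J
    have e1 : ((2 : NNReal) : ENNReal) ≤ ((J + 5 / 4 + 1 / 4 : NNReal) : ENNReal) := by
      push_cast
      exact h3
    have e2 := ENNReal.coe_le_coe.1 e1
    have e3 : (1 / 2 : NNReal) ≤ J := by
      rw [← NNReal.coe_le_coe] at e2 ⊢
      push_cast at e2 ⊢
      linarith
    have := ENNReal.coe_le_coe.2 e3
    rwa [ENNReal.coe_div (by norm_num)] at this

/-- Le Cam's two-point bound for the squared error, in terms of the second moment of the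
likelihood ratio. -/
theorem two_point_bound {π : Measure α} [IsProbabilityMeasure π] {H : α → ENNReal}
    (hH : Measurable H) (h1 : ∫⁻ x, H x ∂π = 1) (h2 : ∫⁻ x, H x ^ 2 ∂π ≤ 5 / 4)
    {f : α → ℝ} (hf : Measurable f) (c₀ c₁ : ℝ) :
    ENNReal.ofReal ((c₀ - c₁) ^ 2 / 4) ≤ ∫⁻ x, ENNReal.ofReal ((f x - c₀) ^ 2) ∂π +
      ∫⁻ x, ENNReal.ofReal ((f x - c₁) ^ 2) ∂(π.withDensity H) := by
  rw [lintegral_withDensity_eq_lintegral_mul _ hH (by fun_prop),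
    ← lintegral_add_left (by fun_prop)]
  calc ENNReal.ofReal ((c₀ - c₁) ^ 2 / 4)
      = 1 / 2 * ENNReal.ofReal ((c₀ - c₁) ^ 2 / 2) := by
        rw [show (1 / 2 : ENNReal) = ENNReal.ofReal (1 / 2) by
          rw [ENNReal.ofReal_div_of_pos (by norm_num)]; simp,
          ← ENNReal.ofReal_mul (by norm_num)]
        congr 1; ring
    _ ≤ (∫⁻ x, min 1 (H x) ∂π) * ENNReal.ofReal ((c₀ - c₁) ^ 2 / 2) := by
        gcongr; exact half_le_lintegral_min_one hH h1 h2
    _ = ∫⁻ x, min 1 (H x) * ENNReal.ofReal ((c₀ - c₁) ^ 2 / 2) ∂π :=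
        (lintegral_mul_const _ (by fun_prop)).symm
    _ ≤ _ := by
        refine lintegral_mono fun x => ?_
        calc min 1 (H x) * ENNReal.ofReal ((c₀ - c₁) ^ 2 / 2)
            ≤ min 1 (H x) * (ENNReal.ofReal ((f x - c₀) ^ 2) +
                ENNReal.ofReal ((f x - c₁) ^ 2)) := by
              gcongr
              rw [← ENNReal.ofReal_add (sq_nonneg _) (sq_nonneg _)]
              refine ENNReal.ofReal_le_ofReal ?_
              nlinarith [sq_nonneg (2 * f x - c₀ - c₁)]
          _ ≤ ENNReal.ofReal ((f x - c₀) ^ 2) + H x * ENNReal.ofReal ((f x - c₁) ^ 2) := by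
              rw [mul_add]
              gcongr
              · exact (mul_le_mul_left (min_le_left _ _) _).trans_eq (one_mul _)
              · exact min_le_right _ _

/-- The second moment of a density that differs from `1` by at most `c` on `s` only. -/
theorem lintegral_sq_le_of_near_one {μ : Measure α} [IsProbabilityMeasure μ] {g : α → ℝ}
    (hg : Measurable g) (hg0 : ∀ x, 0 ≤ g x) (h1 : ∫⁻ x, ENNReal.ofReal (g x) ∂μ = 1)
    {s : Set α} (hs : MeasurableSet s) {c : ℝ}
    (hc : ∀ x, (g x - 1) ^ 2 ≤ s.indicator (fun _ => c) x) :
    ∫⁻ x, ENNReal.ofReal (g x) ^ 2 ∂μ ≤ 1 + ENNReal.ofReal c * μ s := by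
  -- From `g ^ 2 + 1 = 2 g + (g - 1) ^ 2`, arranged without subtraction in `ENNReal`.
  have hpt : ∀ x, ENNReal.ofReal (g x) ^ 2 + 1 ≤
      2 * ENNReal.ofReal (g x) + s.indicator (fun _ => ENNReal.ofReal c) x := by
    intro x
    have hind : s.indicator (fun _ => ENNReal.ofReal c) x =
        ENNReal.ofReal (s.indicator (fun _ => c) x) := by
      by_cases hx : x ∈ s <;> simp [hx]
    have h0 : 0 ≤ s.indicator (fun _ => c) x := (sq_nonneg _).trans (hc x)
    rw [hind, ← ENNReal.ofReal_pow (hg0 x), ← ENNReal.ofReal_one,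
      ← ENNReal.ofReal_add (by positivity) zero_le_one,
      show (2 : ENNReal) = ENNReal.ofReal 2 by simp, ← ENNReal.ofReal_mul (by norm_num),
      ← ENNReal.ofReal_add (by have := hg0 x; positivity) h0]
    refine ENNReal.ofReal_le_ofReal ?_
    nlinarith [hc x]
  have hint := lintegral_mono (μ := μ) hpt
  rw [lintegral_add_right _ measurable_const, lintegral_add_right _ (measurable_const.indicator hs),
    lintegral_const_mul _ (by fun_prop), h1, lintegral_indicator_const hs, lintegral_const,
    measure_univ] at hint
  have h2 : (2 : ENNReal) * 1 = 1 + 1 := by norm_num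
  rw [h2, mul_one, add_right_comm] at hint
  exact (ENNReal.add_le_add_iff_right ENNReal.one_ne_top).1 hint

/-- The two-point bound for an i.i.d. sample. -/
theorem two_point_bound_pi {n : ℕ} {μ ν : Measure α} [IsProbabilityMeasure μ]
    [IsProbabilityMeasure ν] {G : α → ENNReal} (hG : Measurable G) (hν : ν = μ.withDensity G)
    (h2 : (∫⁻ x, G x ^ 2 ∂μ) ^ n ≤ 5 / 4) {f : (Fin n → α) → ℝ} (hf : Measurable f) (c₀ c₁ : ℝ) :
    ENNReal.ofReal ((c₀ - c₁) ^ 2 / 4) ≤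
      ∫⁻ D, ENNReal.ofReal ((f D - c₀) ^ 2) ∂(Measure.pi fun _ : Fin n => μ) +
      ∫⁻ D, ENNReal.ofReal ((f D - c₁) ^ 2) ∂(Measure.pi fun _ : Fin n => ν) := by
  subst hν
  have hG1 : ∫⁻ x, G x ∂μ = 1 := by
    rw [← setLIntegral_univ, ← withDensity_apply _ MeasurableSet.univ, measure_univ]
  rw [pi_withDensity_eq μ hG]
  refine two_point_bound (by fun_prop) ?_ ?_ hf c₀ c₁
  · rw [lintegral_pi_prod_eq_prod μ fun _ => hG]
    simp [hG1]
  -- Second moments of likelihood ratios multiply over independent observations.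
  · simp_rw [← Finset.prod_pow]
    rw [lintegral_pi_prod_eq_prod μ fun _ => hG.pow_const 2]
    simpa using h2

end MeasureTheory

/-! ### The two-cluster law: distribution and quantile functions. -/

noncomputable section

theorem lintegral_Ico_affine {c : ℝ} (hc : 0 < c) (k a b : ℝ) (φ : ℝ → ENNReal) :
    ∫⁻ r in Set.Ico a b, ENNReal.ofReal c * φ (c * r + k) =
      ∫⁻ u in Set.Ico (c * a + k) (c * b + k), φ u := by
  have him : (fun r => c * r + k) '' Set.Ico a b = Set.Ico (c * a + k) (c * b + k) := by
    ext u
    simp only [Set.mem_image, Set.mem_Ico]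
    constructor
    · rintro ⟨r, ⟨h1, h2⟩, rfl⟩
      constructor <;> nlinarith
    · rintro ⟨h1, h2⟩
      refine ⟨(u - k) / c, ⟨?_, ?_⟩, by field_simp; ring⟩
      · rw [le_div_iff₀ hc]; linarith
      · rw [div_lt_iff₀ hc]; linarith
  have h := lintegral_image_eq_lintegral_abs_deriv_mul (f := fun r => c * r + k)
    (f' := fun _ => c) (measurableSet_Ico (a := a) (b := b))
    (fun x _ => by simpa using (((hasDerivAt_id x).const_mul c).add_const k).hasDerivWithinAt)
    (fun x _ y _ hxy => by simpa [hc.ne'] using hxy) φ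
  rw [him, abs_of_pos hc] at h
  exact h.symm

namespace FairRegression

/-- The uniform law on `[0, 1)`. -/
def unifLaw : Measure ℝ := volume.restrict (Set.Ico 0 1)

instance : IsProbabilityMeasure unifLaw := ⟨by simp [unifLaw]⟩

instance : NullSingletonClass unifLaw := by unfold unifLaw; infer_instance

theorem ae_unifLaw_mem : ∀ᵐ r ∂unifLaw, r ∈ Set.Ico (0 : ℝ) 1 :=
  ae_restrict_mem measurableSet_Ico

/-- The sign by which the mass of the lower half of `[0, 1)` is traded for that of the upper. -/
def tilt (r : ℝ) : ℝ := if r < 1 / 2 then 1 else -1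

theorem measurable_tilt : Measurable tilt :=
  Measurable.ite measurableSet_Iio measurable_const measurable_const

theorem abs_tilt (r : ℝ) : |tilt r| = 1 := by
  unfold tilt; split_ifs <;> simp

/-- The distribution function of the tilted law `(1 + 2 b tilt) unifLaw`. -/
def tiltedCdf (b r : ℝ) : ℝ := if r < 1 / 2 then (1 + 2 * b) * r else (1 - 2 * b) * r + 2 * b

/-- The quantile function of the two-cluster law with mass `1 / 2 + b` on the lower cluster
`[-1, -1/2)` and the rest on the upper cluster `[1/2, 1)`. -/
def clusterQuantile (b u : ℝ) : ℝ :=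
  if u < 1 / 2 + b then u / (1 + 2 * b) - 1 else 1 - (1 - u) / (1 - 2 * b)

section scalar

variable {b : ℝ}

/-- The amplitude cancels: the outcome attached to `r` is the same for all `b`. Hence all models can
share one Bayes predictor while its law varies. -/
theorem clusterQuantile_tiltedCdf (hb : 0 ≤ b) (hb1 : b ≤ 1 / 8) (r : ℝ) :
    clusterQuantile b (tiltedCdf b r) = if r < 1 / 2 then r - 1 else r := by
  unfold clusterQuantile tiltedCdf
  have h1 : 1 + 2 * b ≠ 0 := by linarith
  have h2 : 1 - 2 * b ≠ 0 := by linarith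
  by_cases hr : r < 1 / 2
  · rw [if_pos hr, if_pos hr, if_pos (by nlinarith)]
    field_simp
  · rw [if_neg hr, if_neg hr, if_neg (by nlinarith)]
    field_simp
    ring

theorem monotone_clusterQuantile (hb : 0 ≤ b) (hb1 : b ≤ 1 / 8) :
    Monotone (clusterQuantile b) := by
  intro u u' h
  have h1 : 0 < 1 + 2 * b := by linarith
  have h2 : 0 < 1 - 2 * b := by linarith
  unfold clusterQuantile
  split_ifs with hu hu' hu'
  · gcongr
  · have k1 : u / (1 + 2 * b) ≤ 1 / 2 := by rw [div_le_iff₀ h1]; linarith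
    have k2 : (1 - u') / (1 - 2 * b) ≤ 1 / 2 := by rw [div_le_iff₀ h2]; linarith
    linarith
  · linarith
  · gcongr

theorem measurable_tiltedCdf : Measurable fun q : ℝ × ℝ => tiltedCdf q.1 q.2 := by
  unfold tiltedCdf
  exact Measurable.ite (measurableSet_lt (by fun_prop) (by fun_prop)) (by fun_prop) (by fun_prop)

theorem measurable_clusterQuantile : Measurable fun q : ℝ × ℝ => clusterQuantile q.1 q.2 := by
  unfold clusterQuantile
  exact Measurable.ite (measurableSet_lt (by fun_prop) (by fun_prop)) (by fun_prop) (by fun_prop)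

theorem tiltedCdf_mem (hb : 0 ≤ b) (hb1 : b ≤ 1 / 8) {r : ℝ} (hr : r ∈ Set.Ico (0 : ℝ) 1) :
    tiltedCdf b r ∈ Set.Ico (0 : ℝ) 1 := by
  obtain ⟨h0, h1⟩ := hr
  unfold tiltedCdf
  split_ifs <;> constructor <;> nlinarith

theorem abs_clusterQuantile_le (hb : 0 ≤ b) (hb1 : b ≤ 1 / 8) {u : ℝ}
    (hu : u ∈ Set.Ico (0 : ℝ) 1) : |clusterQuantile b u| ≤ 1 := by
  obtain ⟨h0, h1⟩ := hu
  have k1 : 0 < 1 + 2 * b := by linarith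
  have k2 : 0 < 1 - 2 * b := by linarith
  unfold clusterQuantile
  rw [abs_le]
  split_ifs with h
  · have := div_nonneg h0 k1.le
    have : u / (1 + 2 * b) ≤ 1 := by rw [div_le_iff₀ k1]; linarith
    constructor <;> linarith
  · have : 0 ≤ (1 - u) / (1 - 2 * b) := div_nonneg (by linarith) k2.le
    have : (1 - u) / (1 - 2 * b) ≤ 1 := by rw [div_le_iff₀ k2]; linarith
    constructor <;> linarith

/-- Such a level sits in the upper cluster when the amplitude is `0` and in the lower one when it is
`b`, and the clusters are at distance `1`. This jump is the source of the slow rate. -/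
theorem clusterQuantile_gap {r : ℝ} (hr : 1 / 2 ≤ r) (hr' : r < 1 / 2 + b) :
    1 ≤ clusterQuantile 0 r - clusterQuantile b r := by
  have k1 : 0 < 1 + 2 * b := by linarith
  have : r / (1 + 2 * b) ≤ 1 / 2 := by rw [div_le_iff₀ k1]; linarith
  rw [clusterQuantile, clusterQuantile, if_neg (by linarith), if_pos hr']
  norm_num
  linarith

/-- The distribution function of the tilted law transports it to the uniform law. -/
theorem lintegral_tiltedCdf (hb : 0 ≤ b) (hb1 : b ≤ 1 / 8) (φ : ℝ → ENNReal) :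
    ∫⁻ r, ENNReal.ofReal (1 + 2 * b * tilt r) * φ (tiltedCdf b r) ∂unifLaw =
      ∫⁻ u, φ u ∂unifLaw := by
  have split : ∀ (c : ℝ) (ψ : ℝ → ENNReal), 0 ≤ c → c ≤ 1 → ∫⁻ u in Set.Ico (0 : ℝ) 1, ψ u =
      (∫⁻ u in Set.Ico 0 c, ψ u) + ∫⁻ u in Set.Ico c 1, ψ u := by
    intro c ψ h0 h1
    rw [← Set.Ico_union_Ico_eq_Ico h0 h1, lintegral_union measurableSet_Ico]
    exact Set.Ico_disjoint_Ico_same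
  unfold unifLaw
  -- `tiltedCdf b` maps the halves of `[0, 1)` affinely onto `[0, 1/2 + b)` and `[1/2 + b, 1)`, with
  -- slopes equal to the tilted density.
  rw [split (1 / 2) _ (by norm_num) (by norm_num), split (1 / 2 + b) φ (by linarith) (by linarith)]
  congr 1
  · have h := lintegral_Ico_affine (c := 1 + 2 * b) (by linarith) 0 0 (1 / 2) φ
    rw [show (1 + 2 * b) * 0 + 0 = 0 by ring, show (1 + 2 * b) * (1 / 2) + 0 = 1 / 2 + b by ring] at h
    rw [← h]
    refine setLIntegral_congr_fun measurableSet_Ico fun r hr => ?_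
    simp only [tilt, tiltedCdf, if_pos hr.2, mul_one, add_zero]
  · have h := lintegral_Ico_affine (c := 1 - 2 * b) (by linarith) (2 * b) (1 / 2) 1 φ
    rw [show (1 - 2 * b) * (1 / 2) + 2 * b = 1 / 2 + b by ring,
      show (1 - 2 * b) * 1 + 2 * b = 1 by ring] at h
    rw [← h]
    refine setLIntegral_congr_fun measurableSet_Ico fun r hr => ?_
    simp only [tilt, tiltedCdf, if_neg (not_lt.2 hr.1)]
    congr 2; ring

end scalar

/-! ### The tilted causal models. -/

/-- The latent description `((V, S), R)` of a feature vector. -/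
abbrev Latent (K : ℕ) : Type := (unitInterval × Fin K) × ℝ

/-- Uncountable standard Borel spaces are isomorphic. One construction thus serves every `d ≥ 1`,
with features that reveal `V`, `S` and `R`. -/
theorem nonempty_encoding {d K : ℕ} (hd : 1 ≤ d) (hK : 0 < K) :
    Nonempty (Features d ≃ᵐ Latent K) := by
  have : NeZero d := ⟨by omega⟩
  have : NeZero K := ⟨by omega⟩
  refine ⟨PolishSpace.measurableEquivOfNotCountable ?_ ?_⟩
  · intro h
    have hinj : Function.Injective fun t : ℝ => EuclideanSpace.single (0 : Fin d) t :=
      fun a b hab => by simpa using congrArg (fun x : Features d => x 0) hab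
    exact not_countable (α := ℝ) hinj.countable
  · intro h
    have hinj : Function.Injective fun t : ℝ => (((0, 0), t) : Latent K) :=
      fun a b hab => by simpa using hab
    exact not_countable (α := ℝ) hinj.countable

/-- The size of the tilt, as a function of `V`. -/
structure Amplitude where
  toFun : unitInterval → ℝ
  measurable_toFun : Measurable toFun
  nonneg : ∀ v, 0 ≤ toFun v
  le : ∀ v, toFun v ≤ 1 / 8

variable {d K : ℕ} (e : Features d ≃ᵐ Latent K) (s₀ : Fin K) (M : ℝ) (b : Amplitude)

/-- The density of the latent variable `R` given `(V, S)`: tilted in the group `s₀`, uniform in the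
others. -/
def latentDensity (a : unitInterval × Fin K) (r : ℝ) : ℝ :=
  if a.2 = s₀ then 1 + 2 * b.toFun a.1 * tilt r else 1

theorem measurable_latentDensity :
    Measurable fun z : Latent K => latentDensity s₀ b z.1 z.2 := by
  have := b.measurable_toFun
  have := measurable_tilt
  unfold latentDensity
  exact Measurable.ite ((measurableSet_singleton s₀).preimage (by fun_prop)) (by fun_prop)
    measurable_const

theorem latentDensity_mem (a : unitInterval × Fin K) (r : ℝ) :
    latentDensity s₀ b a r ∈ Set.Icc (0 : ℝ) 2 := by
  have h := b.nonneg a.1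
  have h' := b.le a.1
  unfold latentDensity tilt
  split_ifs <;> constructor <;> linarith

theorem lintegral_latentDensity (a : unitInterval × Fin K) :
    ∫⁻ r, ENNReal.ofReal (latentDensity s₀ b a r) ∂unifLaw = 1 := by
  unfold latentDensity
  split_ifs
  · have := lintegral_tiltedCdf (b.nonneg a.1) (b.le a.1) fun _ => 1
    simpa using this
  · simp

/-- The law of the latent variable `R` given `(V, S)`. -/
def latentKernel : Kernel (unitInterval × Fin K) ℝ :=
  Kernel.withDensity (Kernel.const _ unifLaw)
    fun a r => ENNReal.ofReal (latentDensity s₀ b a r)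

theorem latentKernel_apply (a : unitInterval × Fin K) :
    latentKernel s₀ b a =
      unifLaw.withDensity fun r => ENNReal.ofReal (latentDensity s₀ b a r) := by
  rw [latentKernel, Kernel.withDensity_apply, Kernel.const_apply]
  exact (measurable_latentDensity s₀ b).ennreal_ofReal

instance : IsMarkovKernel (latentKernel s₀ b) := by
  refine ⟨fun a => ⟨?_⟩⟩
  rw [latentKernel_apply, withDensity_apply _ MeasurableSet.univ, setLIntegral_univ,
    lintegral_latentDensity]

/-- The law of the features given `(V, S)`: the encoded latent description. -/
def tiltedFeatureLaw : Kernel (unitInterval × Fin K) (Features d) :=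
  (Kernel.id ×ₖ latentKernel s₀ b).map e.symm

instance : IsMarkovKernel (tiltedFeatureLaw e s₀ b) :=
  Kernel.IsMarkovKernel.map _ e.symm.measurable

theorem tiltedFeatureLaw_apply (a : unitInterval × Fin K) :
    tiltedFeatureLaw e s₀ b a = (latentKernel s₀ b a).map fun r => e.symm (a, r) := by
  rw [tiltedFeatureLaw, Kernel.map_apply _ e.symm.measurable, Kernel.prod_apply, Kernel.id_apply,
    Measure.dirac_prod, Measure.map_map e.symm.measurable (by fun_prop)]
  rfl

theorem lintegral_tiltedFeatureLaw (a : unitInterval × Fin K) {φ : Features d → ENNReal}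
    (hφ : Measurable φ) :
    ∫⁻ x, φ x ∂(tiltedFeatureLaw e s₀ b a) =
      ∫⁻ r, ENNReal.ofReal (latentDensity s₀ b a r) * φ (e.symm (a, r)) ∂unifLaw := by
  have hs := e.symm.measurable
  have hd := (measurable_latentDensity s₀ b).comp (measurable_prodMk_left (x := a))
  have hd' : Measurable fun r => latentDensity s₀ b a r := hd
  rw [tiltedFeatureLaw_apply, lintegral_map hφ (by fun_prop), latentKernel_apply,
    lintegral_withDensity_eq_lintegral_mul _ hd'.ennreal_ofReal (by fun_prop)]
  rfl

theorem ae_tiltedFeatureLaw {a : unitInterval × Fin K} {p : Features d → Prop}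
    (hp : ∀ r ∈ Set.Ico (0 : ℝ) 1, p (e.symm (a, r))) (hpm : MeasurableSet {x | p x}) :
    ∀ᵐ x ∂(tiltedFeatureLaw e s₀ b a), p x := by
  have hs := e.symm.measurable
  rw [tiltedFeatureLaw_apply, ae_map_iff (by fun_prop) hpm, latentKernel_apply]
  refine (withDensity_absolutelyContinuous unifLaw _).ae_le ?_
  filter_upwards [ae_unifLaw_mem] with r hr using hp r hr

/-- The outcome as a function of the latent description: two clusters in the group `s₀`. -/
def latentValue (z : Latent K) : ℝ :=
  if z.1.2 = s₀ ∧ z.2 < 1 / 2 then M * (z.2 - 1) else M * z.2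

theorem measurable_latentValue : Measurable (latentValue s₀ M) := by
  unfold latentValue
  have h₁ : MeasurableSet {z : Latent K | z.1.2 = s₀} :=
    (measurableSet_singleton s₀).preimage (by fun_prop)
  have h₂ : MeasurableSet {z : Latent K | z.2 < 1 / 2} :=
    measurableSet_lt (by fun_prop) (by fun_prop)
  exact Measurable.ite (h₁.inter h₂) (by fun_prop) (by fun_prop)

theorem abs_latentValue_le (hM : 0 < M) (a : unitInterval × Fin K) {r : ℝ}
    (hr : r ∈ Set.Ico (0 : ℝ) 1) : |latentValue s₀ M (a, r)| ≤ M := by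
  obtain ⟨h0, h1⟩ := hr
  unfold latentValue
  rw [abs_le]
  split_ifs <;> constructor <;> nlinarith

/-- The clusters are disjoint. Injectivity transfers the absence of atoms from `R` to the Bayes
prediction. -/
theorem latentValue_injective (hM : 0 < M) (a : unitInterval × Fin K) :
    Function.Injective fun r => latentValue s₀ M (a, r) := by
  intro r r' h
  simp only [latentValue] at h
  split_ifs at h with h1 h2 h2
  · have := mul_left_cancel₀ hM.ne' h; linarith
  · have := mul_left_cancel₀ hM.ne' h
    have : ¬ r' < 1 / 2 := fun hc => h2 ⟨h1.1, hc⟩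
    linarith [h1.2]
  · have := mul_left_cancel₀ hM.ne' h
    have : ¬ r < 1 / 2 := fun hc => h1 ⟨h2.1, hc⟩
    linarith [h2.2]
  · exact mul_left_cancel₀ hM.ne' h

/-- The outcome is a deterministic function of the features. -/
def valueKernel : Kernel (Features d) ℝ :=
  Kernel.deterministic (fun x => latentValue s₀ M (e x))
    ((measurable_latentValue s₀ M).comp e.measurable)

instance : IsMarkovKernel (valueKernel e s₀ M) := by
  unfold valueKernel; infer_instance

instance (w : Fin K → ℝ) : IsFiniteMeasure (groupLaw w) := by
  refine ⟨?_⟩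
  rw [groupLaw, Measure.sum_apply _ MeasurableSet.univ, tsum_fintype]
  simp

theorem isProbabilityMeasure_groupLaw {w : Fin K → ℝ} (hw : ∀ s, 0 < w s)
    (hw1 : ∑ s, w s = 1) : IsProbabilityMeasure (groupLaw w) := by
  refine ⟨?_⟩
  rw [groupLaw, Measure.sum_apply _ MeasurableSet.univ, tsum_fintype]
  simp only [Measure.smul_apply, measure_univ, smul_eq_mul, mul_one]
  rw [← ENNReal.ofReal_sum_of_nonneg fun s _ => (hw s).le, hw1, ENNReal.ofReal_one]

/-- The untilted law of the latent description. -/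
def latentBase (w : Fin K → ℝ) : Measure (Latent K) :=
  ((volume : Measure unitInterval).prod (groupLaw w)).prod unifLaw

instance (w : Fin K → ℝ) : IsFiniteMeasure (latentBase w) := by
  unfold latentBase; infer_instance

/-- The observation that belongs to a latent description. -/
def latentObs (z : Latent K) : Obs d K := ((z.1, e.symm z), latentValue s₀ M z)

theorem measurable_latentObs : Measurable (latentObs e s₀ M) := by
  have := measurable_latentValue s₀ M
  have := e.symm.measurable
  unfold latentObs
  fun_prop

/-- The joint law of the tilted model, as the image of a law with a density. -/
theorem jointLaw_tilted (w : Fin K → ℝ) :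
    jointLaw w (tiltedFeatureLaw e s₀ b) (valueKernel e s₀ M) =
      ((latentBase w).withDensity fun z => ENNReal.ofReal (latentDensity s₀ b z.1 z.2)).map
        (latentObs e s₀ M) := by
  have hobs := measurable_latentObs e s₀ M
  have hval := measurable_latentValue s₀ M
  have hden := measurable_latentDensity s₀ b
  have hs := e.symm.measurable
  have he := e.measurable
  refine Measure.ext_of_lintegral _ fun φ hφ => ?_
  rw [lintegral_map hφ hobs,
    lintegral_withDensity_eq_lintegral_mul _ hden.ennreal_ofReal (by fun_prop), latentBase,
    lintegral_prod _ (by fun_prop), jointLaw, Measure.lintegral_compProd hφ]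
  have hinner : ∀ c : (unitInterval × Fin K) × Features d,
      ∫⁻ y, φ (c, y) ∂(Kernel.prodMkLeft (unitInterval × Fin K) (valueKernel e s₀ M) c) =
        φ (c, latentValue s₀ M (e c.2)) := by
    intro c
    rw [Kernel.prodMkLeft_apply, valueKernel, Kernel.deterministic_apply,
      lintegral_dirac' _ (by fun_prop)]
  simp_rw [hinner]
  rw [Measure.lintegral_compProd (by fun_prop)]
  refine lintegral_congr fun a => ?_
  rw [lintegral_tiltedFeatureLaw e s₀ b a (by fun_prop)]
  simp [latentObs]

theorem jointLaw_tilted_ae {w : Fin K → ℝ} {p : Obs d K → Prop}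
    (hp : ∀ a, ∀ r ∈ Set.Ico (0 : ℝ) 1, p (latentObs e s₀ M (a, r)))
    (hpm : MeasurableSet {o | p o}) :
    ∀ᵐ o ∂(jointLaw w (tiltedFeatureLaw e s₀ b) (valueKernel e s₀ M)), p o := by
  have hobs := measurable_latentObs e s₀ M
  rw [jointLaw_tilted, ae_map_iff hobs.aemeasurable hpm]
  refine (withDensity_absolutelyContinuous _ _).ae_le ?_
  refine (Measure.ae_prod_iff_ae_ae (hpm.preimage hobs)).2 (ae_of_all _ fun a => ?_)
  filter_upwards [ae_unifLaw_mem] with r hr using hp a r hr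

theorem measurable_predictorInput : Measurable (predictorInput (d := d) (K := K)) := by
  unfold predictorInput; fun_prop

/-- The causal model in which the group `s₀` is tilted by the amplitude `b`. -/
def tiltedModel (hM : 0 < M) (w : Fin K → ℝ) : CausalModel d K w where
  featureLaw := tiltedFeatureLaw e s₀ b
  isMarkov_featureLaw := inferInstance
  outcomeLaw := valueKernel e s₀ M
  isMarkov_outcomeLaw := inferInstance
  integrable_outcome := by
    have : IsFiniteMeasure (jointLaw w (tiltedFeatureLaw e s₀ b) (valueKernel e s₀ M)) := by
      unfold jointLaw; infer_instance
    refine Integrable.of_bound (by fun_prop) M ?_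
    exact jointLaw_tilted_ae e s₀ M b (fun a r hr => abs_latentValue_le s₀ M hM a hr)
      (measurableSet_le (by fun_prop) measurable_const)
  abduct := fun q => (e q.1).1.1
  measurable_abduct := by have := e.measurable; fun_prop
  abduct_eq := fun v s => ae_tiltedFeatureLaw e s₀ b (by simp)
    ((measurableSet_singleton v).preimage (by have := e.measurable; fun_prop))
  bayes := fun q => latentValue s₀ M (e q.1)
  measurable_bayes := by
    have := e.measurable
    have := measurable_latentValue s₀ M
    fun_prop
  bayes_ae_eq := by
    have : IsFiniteMeasure (jointLaw w (tiltedFeatureLaw e s₀ b) (valueKernel e s₀ M)) := by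
      unfold jointLaw; infer_instance
    have he := e.measurable
    have hval := measurable_latentValue s₀ M
    have hin := measurable_predictorInput (d := d) (K := K)
    have hb : Measurable fun q : Features d × Fin K => latentValue s₀ M (e q.1) := by fun_prop
    -- The outcome is almost surely a function of the features, hence its own conditional
    -- expectation.
    have hY : (fun o : Obs d K => o.2) =ᵐ[jointLaw w (tiltedFeatureLaw e s₀ b)
        (valueKernel e s₀ M)] fun o => latentValue s₀ M (e (predictorInput o).1) :=
      jointLaw_tilted_ae e s₀ M b (fun a r _ => by simp [latentObs, predictorInput])
        (measurableSet_eq_fun (by fun_prop) (by fun_prop))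
    refine Filter.EventuallyEq.trans ?_ (condExp_congr_ae hY.symm)
    rw [condExp_of_stronglyMeasurable hin.comap_le]
    · exact (hb.comp (comap_measurable _)).stronglyMeasurable
    · have hm : Measurable fun o : Obs d K => latentValue s₀ M (e (predictorInput o).1) := by
        fun_prop
      refine Integrable.of_bound hm.aestronglyMeasurable M ?_
      refine jointLaw_tilted_ae e s₀ M b (fun a r hr => ?_)
        (measurableSet_le (by fun_prop) measurable_const)
      simpa [latentObs, predictorInput] using abs_latentValue_le s₀ M hM a hr

end FairRegression

/-! ### Membership in the class and the optimal fair predictor. -/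

namespace FairRegression

variable {d K : ℕ} (e : Features d ≃ᵐ Latent K) (s₀ : Fin K) (M : ℝ) (b : Amplitude)

theorem predLaw_tiltedModel (hM : 0 < M) (w : Fin K → ℝ) {f : Features d × Fin K → ℝ}
    (hf : Measurable f) (v : unitInterval) (s : Fin K) :
    (tiltedModel e s₀ M b hM w).predLaw f v s =
      (latentKernel s₀ b (v, s)).map fun r => f (e.symm ((v, s), r), s) := by
  have hs := e.symm.measurable
  have hf' : Measurable fun x => f (x, s) := by fun_prop
  rw [CausalModel.predLaw, show (tiltedModel e s₀ M b hM w).featureLaw =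
    tiltedFeatureLaw e s₀ b from rfl, tiltedFeatureLaw_apply, Measure.map_map hf' (by fun_prop)]
  rfl

theorem predLaw_bayes_tiltedModel (hM : 0 < M) (w : Fin K → ℝ) (v : unitInterval) (s : Fin K) :
    (tiltedModel e s₀ M b hM w).predLaw (tiltedModel e s₀ M b hM w).bayes v s =
      (latentKernel s₀ b (v, s)).map fun r => latentValue s₀ M ((v, s), r) := by
  rw [predLaw_tiltedModel e s₀ M b hM w (tiltedModel e s₀ M b hM w).measurable_bayes]
  simp [tiltedModel]

theorem latentKernel_absolutelyContinuous (a : unitInterval × Fin K) :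
    latentKernel s₀ b a ≪ unifLaw := by
  rw [latentKernel_apply]
  exact withDensity_absolutelyContinuous _ _

theorem latentKernel_real (a : unitInterval × Fin K) {B : Set ℝ} (hB : MeasurableSet B) :
    (latentKernel s₀ b a).real B = ∫ r in B, latentDensity s₀ b a r ∂unifLaw := by
  have hd : Measurable fun r => latentDensity s₀ b a r :=
    (measurable_latentDensity s₀ b).comp (measurable_prodMk_left (x := a))
  rw [integral_eq_lintegral_of_nonneg_ae (ae_of_all _ fun r => (latentDensity_mem s₀ b a r).1)
    hd.aestronglyMeasurable, Measure.real, latentKernel_apply, withDensity_apply _ hB]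

theorem integrable_latentDensity (a : unitInterval × Fin K) :
    Integrable (latentDensity s₀ b a) unifLaw := by
  have hd : Measurable fun r => latentDensity s₀ b a r :=
    (measurable_latentDensity s₀ b).comp (measurable_prodMk_left (x := a))
  refine Integrable.of_bound hd.aestronglyMeasurable 2 (ae_of_all _ fun r => ?_)
  have := latentDensity_mem s₀ b a r
  rw [Real.norm_eq_abs, abs_of_nonneg this.1]
  exact this.2

/-- The densities differ by at most `2 * |b v - b v'|` pointwise. Uniformity in the event covers
every threshold of the c.d.f. at once. -/
theorem latentKernel_lipschitz (v v' : unitInterval) (s : Fin K) {B : Set ℝ}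
    (hB : MeasurableSet B) :
    |(latentKernel s₀ b (v, s)).real B - (latentKernel s₀ b (v', s)).real B| ≤
      2 * |b.toFun v - b.toFun v'| := by
  rw [latentKernel_real s₀ b _ hB, latentKernel_real s₀ b _ hB,
    ← integral_sub (integrable_latentDensity s₀ b _).integrableOn
      (integrable_latentDensity s₀ b _).integrableOn, ← Real.norm_eq_abs]
  refine (norm_setIntegral_le_of_norm_le_const (C := 2 * |b.toFun v - b.toFun v'|)
    (measure_lt_top _ _) fun r _ => ?_).trans ?_
  · unfold latentDensity
    split_ifs
    · rw [show 1 + 2 * b.toFun (v, s).1 * tilt r - (1 + 2 * b.toFun (v', s).1 * tilt r) =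
        2 * (b.toFun v - b.toFun v') * tilt r by ring, Real.norm_eq_abs, abs_mul, abs_mul,
        abs_tilt]
      simp
    · simp
  · exact mul_le_of_le_one_right (by positivity) measureReal_le_one

/-- A slowly varying amplitude yields a member of the class. -/
theorem inClass_tiltedModel (hM : 0 < M) (w : Fin K → ℝ) {L : ℝ}
    (hL : ∀ v v' : unitInterval, 2 * |b.toFun v - b.toFun v'| ≤ L * |(v : ℝ) - v'|) :
    (tiltedModel e s₀ M b hM w).InClass M L := by
  have hval := measurable_latentValue s₀ M
  have hval' : ∀ a : unitInterval × Fin K, Measurable fun r => latentValue s₀ M (a, r) :=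
    fun a => by fun_prop
  refine ⟨fun v s => ⟨⟨fun y => ?_⟩, ?_⟩, fun s t v v' => ?_⟩
  · rw [predLaw_bayes_tiltedModel, Measure.map_apply (hval' _) (measurableSet_singleton y)]
    refine latentKernel_absolutelyContinuous s₀ b _ ?_
    exact ((Set.subsingleton_singleton).preimage
      (latentValue_injective s₀ M hM (v, s))).measure_zero _
  · rw [predLaw_bayes_tiltedModel, Measure.map_apply (hval' _) measurableSet_Icc.compl]
    refine latentKernel_absolutelyContinuous s₀ b _ ?_
    rw [← nonpos_iff_eq_zero, ← ae_iff.1 ae_unifLaw_mem]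
    refine measure_mono fun r hr hr' => hr ?_
    exact abs_le.1 (abs_latentValue_le s₀ M hM (v, s) hr')
  · have : ∀ v, IsProbabilityMeasure
        ((latentKernel s₀ b (v, s)).map fun r => latentValue s₀ M ((v, s), r)) :=
      fun v => Measure.isProbabilityMeasure_map (hval' _).aemeasurable
    rw [predLaw_bayes_tiltedModel, predLaw_bayes_tiltedModel, cdf_eq_real, cdf_eq_real,
      map_measureReal_apply (hval' _) measurableSet_Iic,
      map_measureReal_apply (hval' _) measurableSet_Iic]
    -- `latentValue` does not depend on `v`; only the law of `R` does.
    have hset : (fun r => latentValue s₀ M ((v', s), r)) ⁻¹' Set.Iic t =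
        (fun r => latentValue s₀ M ((v, s), r)) ⁻¹' Set.Iic t := rfl
    rw [hset]
    exact (latentKernel_lipschitz s₀ b v v' s ((hval' _) measurableSet_Iic)).trans (hL v v')

/-- The quantile level of a latent description within its group. -/
def latentLevel (z : Latent K) : ℝ :=
  if z.1.2 = s₀ then tiltedCdf (b.toFun z.1.1) z.2 else z.2

/-- The barycenter of the two-cluster law, with weight `α`, and the uniform law, evaluated at the
quantile level of a latent description. -/
def latentFair (α : ℝ) (z : Latent K) : ℝ :=
  M * (α * clusterQuantile (b.toFun z.1.1) (latentLevel s₀ b z) + (1 - α) * latentLevel s₀ b z)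

theorem measurable_latentLevel : Measurable (latentLevel s₀ b) := by
  have := b.measurable_toFun
  have h : Measurable fun z : Latent K => tiltedCdf (b.toFun z.1.1) z.2 :=
    measurable_tiltedCdf.comp (f := fun z : Latent K => (b.toFun z.1.1, z.2)) (by fun_prop)
  unfold latentLevel
  exact Measurable.ite ((measurableSet_singleton s₀).preimage (by fun_prop)) h (by fun_prop)

theorem measurable_latentFair (α : ℝ) : Measurable (latentFair s₀ M b α) := by
  have hb := b.measurable_toFun
  have hl := measurable_latentLevel s₀ b
  have h : Measurable fun z : Latent K => clusterQuantile (b.toFun z.1.1) (latentLevel s₀ b z) :=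
    measurable_clusterQuantile.comp
      (f := fun z : Latent K => (b.toFun z.1.1, latentLevel s₀ b z)) (by fun_prop)
  unfold latentFair
  fun_prop

theorem abs_latentFair_le (hM : 0 < M) {α : ℝ} (h0 : 0 ≤ α) (h1 : α ≤ 1)
    (a : unitInterval × Fin K) {r : ℝ} (hr : r ∈ Set.Ico (0 : ℝ) 1) :
    |latentFair s₀ M b α (a, r)| ≤ M := by
  have hl : latentLevel s₀ b (a, r) ∈ Set.Ico (0 : ℝ) 1 := by
    unfold latentLevel
    split_ifs
    · exact tiltedCdf_mem (b.nonneg _) (b.le _) hr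
    · exact hr
  have hq := abs_le.1 (abs_clusterQuantile_le (b.nonneg a.1) (b.le a.1) hl)
  unfold latentFair
  rw [abs_mul, abs_of_pos hM]
  refine mul_le_of_le_one_right hM.le ?_
  rw [abs_le]
  have := hl.1
  have := hl.2
  constructor <;> nlinarith

/-- The optimal fair predictor of the tilted model. -/
def tiltedFair (w : Fin K → ℝ) (q : Features d × Fin K) : ℝ :=
  latentFair s₀ M b (w s₀) (e q.1)

theorem measurable_tiltedFair (w : Fin K → ℝ) : Measurable (tiltedFair e s₀ M b w) := by
  have he := e.measurable
  have h := measurable_latentFair s₀ M b (w s₀)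
  unfold tiltedFair
  fun_prop

/-- In every group the quantile level is uniform given `V`, and the prediction is a function of the
level and `V` alone. The right-hand side does not mention the group, whence fairness. -/
theorem map_tiltedFair (w : Fin K → ℝ) (a : unitInterval × Fin K) (s : Fin K) :
    (tiltedFeatureLaw e s₀ b a).map (fun x => tiltedFair e s₀ M b w (x, s)) =
      unifLaw.map fun u => M * (w s₀ * clusterQuantile (b.toFun a.1) u + (1 - w s₀) * u) := by
  have hf := measurable_tiltedFair e s₀ M b w
  have hc : Measurable (clusterQuantile (b.toFun a.1)) :=
    measurable_clusterQuantile.comp (measurable_prodMk_left (x := b.toFun a.1))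
  refine Measure.ext_of_lintegral _ fun φ hφ => ?_
  rw [lintegral_map hφ (by fun_prop), lintegral_map hφ (by fun_prop),
    lintegral_tiltedFeatureLaw e s₀ b a (by fun_prop)]
  simp only [tiltedFair, latentFair, latentLevel, latentDensity, MeasurableEquiv.apply_symm_apply]
  split_ifs
  · exact lintegral_tiltedCdf (b.nonneg a.1) (b.le a.1)
      fun u => φ (M * (w s₀ * clusterQuantile (b.toFun a.1) u + (1 - w s₀) * u))
  · simp

theorem isCF_tiltedFair (hM : 0 < M) (w : Fin K → ℝ) :
    (tiltedModel e s₀ M b hM w).IsCF (tiltedFair e s₀ M b w) := by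
  intro s s' x
  have h := fun t => map_tiltedFair e s₀ M b w
    ((tiltedModel e s₀ M b hM w).abduct (x, s), t) t
  exact (h s).trans (h s').symm

theorem isOptimalFair_tiltedFair (hM : 0 < M) {w : Fin K → ℝ} (hw : ∀ s, 0 < w s)
    (hw1 : ∑ s, w s = 1) (hw₀ : w s₀ < 1) :
    (tiltedModel e s₀ M b hM w).IsOptimalFair (tiltedFair e s₀ M b w) := by
  have he := e.measurable
  have hval := measurable_latentValue s₀ M
  have hfair := measurable_latentFair s₀ M b (w s₀)
  refine CausalModel.isOptimalFair_of_potentials _ hw hw1 (measurable_tiltedFair e s₀ M b w)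
    (isCF_tiltedFair e s₀ M b hM w) (B := M) (fun v s => ?_) (fun v s => ?_) fun v => ?_
  · refine ae_tiltedFeatureLaw e s₀ b (fun r hr => ?_)
      (measurableSet_le (f := fun x => |latentValue s₀ M (e x)|) (by fun_prop) measurable_const)
    simpa [tiltedModel] using abs_latentValue_le s₀ M hM (v, s) hr
  · refine ae_tiltedFeatureLaw e s₀ b (fun r hr => ?_)
      (measurableSet_le (f := fun x => |latentFair s₀ M b (w s₀) (e x)|) (by fun_prop)
        measurable_const)
    simpa [tiltedFair] using abs_latentFair_le s₀ M b hM (hw s₀).le hw₀.le (v, s) hr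
  -- On the scale `[0, M)` the common law of the other groups has the identity as quantile function,
  -- and `T` is that of `s₀`.
  set T : ℝ → ℝ := fun u => M * clusterQuantile (b.toFun v) (u / M) with hT
  have hTm : Monotone T := fun u u' h => mul_le_mul_of_nonneg_left
    (monotone_clusterQuantile (b.nonneg v) (b.le v) (div_le_div_of_nonneg_right h hM.le)) hM.le
  obtain ⟨φ, ψ, hφ, hψ, ⟨C, hC⟩, hsum, hsub, hsub'⟩ :=
    exists_barycenter_potentials (hw s₀) (sub_pos.2 hw₀) hTm
  -- The groups other than `s₀` have the same Bayes law, so they share one potential of total weight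
  -- `1 - w s₀`.
  refine ⟨fun s => if s = s₀ then φ else ψ, fun s => ?_, ⟨C, fun s z => ?_⟩, fun z => ?_,
    fun s => ?_⟩
  · beta_reduce
    split_ifs <;> assumption
  · beta_reduce
    split_ifs
    exacts [(hC z).1, (hC z).2]
  · beta_reduce
    rw [← hsum z, ← Finset.add_sum_erase _ _ (Finset.mem_univ s₀), if_pos rfl]
    congr 1
    have hrest : ∑ s ∈ Finset.univ.erase s₀, w s = 1 - w s₀ := by
      rw [← hw1, ← Finset.add_sum_erase _ w (Finset.mem_univ s₀)]; ring
    rw [← hrest, Finset.sum_mul]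
    refine Finset.sum_congr rfl fun s hs => ?_
    rw [if_neg (Finset.ne_of_mem_erase hs)]
  · have hA : ∀ r, w s₀ * T (M * latentLevel s₀ b ((v, s), r)) +
        (1 - w s₀) * (M * latentLevel s₀ b ((v, s), r)) =
        latentFair s₀ M b (w s₀) ((v, s), r) := by
      intro r
      simp only [hT, latentFair]
      rw [mul_div_cancel_left₀ _ hM.ne']
      ring
    have hpt : ∀ r z, (if s = s₀ then φ else ψ) (latentFair s₀ M b (w s₀) ((v, s), r)) +
        latentValue s₀ M ((v, s), r) * (z - latentFair s₀ M b (w s₀) ((v, s), r)) ≤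
        (if s = s₀ then φ else ψ) z := by
      intro r z
      rw [← hA r]
      split_ifs with hs
      · have h := hsub (M * latentLevel s₀ b ((v, s), r)) z
        have hTv : T (M * latentLevel s₀ b ((v, s), r)) = latentValue s₀ M ((v, s), r) := by
          simp only [hT, latentLevel, latentValue, hs, if_true, true_and]
          rw [mul_div_cancel_left₀ _ hM.ne', clusterQuantile_tiltedCdf (b.nonneg v) (b.le v)]
          split_ifs <;> rfl
        rwa [hTv] at h ⊢
      · have h := hsub' (M * latentLevel s₀ b ((v, s), r)) z
        have hl : M * latentLevel s₀ b ((v, s), r) = latentValue s₀ M ((v, s), r) := by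
          simp [latentLevel, latentValue, hs]
        rwa [hl] at h ⊢
    have hx : ∀ᵐ x ∂(tiltedFeatureLaw e s₀ b (v, s)), (e x).1 = (v, s) :=
      ae_tiltedFeatureLaw e s₀ b (by simp)
        ((measurableSet_singleton (v, s)).preimage (by fun_prop))
    filter_upwards [hx] with x hx z
    have h := hpt (e x).2 z
    rw [← hx] at h
    simpa [tiltedFair, tiltedModel] using h

/-- Raising the amplitude moves the optimal fair predictor by a constant in the other groups. -/
theorem latentFair_gap (hM : 0 < M) {α : ℝ} (hα : 0 < α) (b b' : Amplitude) {z : Latent K}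
    (hs : z.1.2 ≠ s₀) (hb : b.toFun z.1.1 = 0) (h₁ : 1 / 2 ≤ z.2)
    (h₂ : z.2 < 1 / 2 + b'.toFun z.1.1) :
    (α * M) ^ 2 ≤ (latentFair s₀ M b α z - latentFair s₀ M b' α z) ^ 2 := by
  have hgap := clusterQuantile_gap h₁ h₂
  have heq : latentFair s₀ M b α z - latentFair s₀ M b' α z =
      α * M * (clusterQuantile 0 z.2 - clusterQuantile (b'.toFun z.1.1) z.2) := by
    simp only [latentFair, latentLevel, hs, if_false, hb]
    ring
  rw [heq]
  refine pow_le_pow_left₀ (by positivity) ?_ 2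
  exact le_mul_of_one_le_right (by positivity) hgap

end FairRegression

/-! ### Bins and bumps. -/

namespace FairRegression

section bins

variable {m : ℕ} {c : ℝ}

/-- The bin of width `1 / m` that contains `v`. -/
def bin (m : ℕ) (v : unitInterval) : Fin (m + 1) :=
  -- The endpoint `v = 1` has floor `m`, which is why there are `m + 1` bins.
  ⟨⌊(m : ℝ) * v⌋₊, Nat.lt_succ_of_le (Nat.floor_le_of_le
    (mul_le_of_le_one_right (Nat.cast_nonneg m) v.2.2))⟩

theorem measurable_bin (m : ℕ) : Measurable (bin m) := by
  have h : Measurable fun v : unitInterval => ⌊(m : ℝ) * v⌋₊ :=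
    Nat.measurable_floor.comp (by fun_prop)
  refine measurable_to_countable' fun j => ?_
  have : bin m ⁻¹' {j} = (fun v : unitInterval => ⌊(m : ℝ) * v⌋₊) ⁻¹' {(j : ℕ)} := by
    ext v; simp [bin, Fin.ext_iff]
  rw [this]
  exact h (measurableSet_singleton _)

theorem volume_bin_le (hm : 0 < m) (j : Fin (m + 1)) :
    volume {v : unitInterval | bin m v = j} ≤ ENNReal.ofReal (1 / m) := by
  have hm' : (0 : ℝ) < m := by exact_mod_cast hm
  have hsub : {v : unitInterval | bin m v = j} ⊆
      (fun v : unitInterval => (v : ℝ)) ⁻¹' Set.Ico ((j : ℝ) / m) ((j + 1) / m) := by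
    rintro v rfl
    have h0 : (0 : ℝ) ≤ m * v := mul_nonneg hm'.le v.2.1
    constructor
    · rw [div_le_iff₀ hm', mul_comm]
      exact Nat.floor_le h0
    · rw [lt_div_iff₀ hm', mul_comm]
      exact Nat.lt_floor_add_one _
  refine (measure_mono hsub).trans ?_
  rw [unitInterval.measurePreserving_coe.measure_preimage measurableSet_Ico.nullMeasurableSet]
  refine (Measure.restrict_apply_le _ _).trans ?_
  rw [Real.volume_Ico]
  refine ENNReal.ofReal_le_ofReal (le_of_eq ?_)
  field_simp
  ring

/-- A bump of height `c / m` on each interval between multiples of `1 / m`. -/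
def bump (m : ℕ) (c x : ℝ) : ℝ := c / m * Real.sin (Real.pi * (m * x)) ^ 2

theorem bump_nonneg (hc : 0 ≤ c) (x : ℝ) : 0 ≤ bump m c x := by unfold bump; positivity

theorem bump_le (hc : 0 ≤ c) (x : ℝ) : bump m c x ≤ c / m :=
  mul_le_of_le_one_right (by positivity) (Real.sin_sq_le_one _)

theorem bump_le_const (hm : 0 < m) (hc : 0 ≤ c) (x : ℝ) : bump m c x ≤ c :=
  (bump_le hc x).trans (div_le_self hc (by exact_mod_cast hm))

theorem bump_lipschitz (hm : 0 < m) (hc : 0 ≤ c) (x y : ℝ) :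
    |bump m c x - bump m c y| ≤ c * Real.pi * |x - y| := by
  have hm' : (0 : ℝ) < m := by exact_mod_cast hm
  have hsin : ∀ a b : ℝ, Real.sin a ^ 2 - Real.sin b ^ 2 = Real.sin (a + b) * Real.sin (a - b) := by
    intro a b
    rw [Real.sin_add, Real.sin_sub]
    have h1 := Real.sin_sq_add_cos_sq a
    have h2 := Real.sin_sq_add_cos_sq b
    linear_combination Real.sin b ^ 2 * h1 - Real.sin a ^ 2 * h2
  have h : |Real.sin (Real.pi * (m * x)) ^ 2 - Real.sin (Real.pi * (m * y)) ^ 2| ≤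
      Real.pi * m * |x - y| := by
    rw [hsin, abs_mul]
    refine (mul_le_of_le_one_left (abs_nonneg _) (Real.abs_sin_le_one _)).trans ?_
    refine Real.abs_sin_le_abs.trans (le_of_eq ?_)
    rw [show Real.pi * (m * x) - Real.pi * (m * y) = Real.pi * m * (x - y) by ring, abs_mul,
      abs_of_pos (by positivity)]
  unfold bump
  rw [← mul_sub, abs_mul, abs_of_nonneg (by positivity)]
  refine (mul_le_mul_of_nonneg_left h (by positivity)).trans (le_of_eq ?_)
  field_simp

theorem bump_grid (hm : 0 < m) (k : ℕ) : bump m c (k / m) = 0 := by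
  have hm' : (m : ℝ) ≠ 0 := by exact_mod_cast hm.ne'
  rw [bump, mul_div_cancel₀ _ hm', mul_comm Real.pi, Real.sin_nat_mul_pi]
  simp

/-- The bumps on the bins selected by `σ`. -/
def binAmplitude (hm : 0 < m) (hc : 0 ≤ c) (hc' : c ≤ 1 / 8) (σ : Fin (m + 1) → Bool) :
    Amplitude where
  toFun := fun v => if σ (bin m v) = true then bump m c v else 0
  measurable_toFun := by
    refine Measurable.ite ?_ (by unfold bump; fun_prop) measurable_const
    exact (measurable_bin m) (t := {j | σ j = true}) (Set.toFinite _).measurableSet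
  nonneg := fun v => by
    split_ifs
    exacts [bump_nonneg hc _, le_refl 0]
  le := fun v => by
    split_ifs
    exacts [(bump_le_const hm hc _).trans hc', by norm_num]

/-- The bumps vanish at the multiples of `1 / m`, so any selection of them stays continuous and
keeps the Lipschitz constant of the full bump function. -/
theorem binAmplitude_lipschitz (hm : 0 < m) (hc : 0 ≤ c) (hc' : c ≤ 1 / 8)
    (σ : Fin (m + 1) → Bool) (v v' : unitInterval) :
    |(binAmplitude hm hc hc' σ).toFun v - (binAmplitude hm hc hc' σ).toFun v'| ≤
      c * Real.pi * |(v : ℝ) - v'| := by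
  have hm' : (0 : ℝ) < m := by exact_mod_cast hm
  wlog hle : (v : ℝ) ≤ v' generalizing v v'
  · rw [abs_sub_comm, abs_sub_comm (v : ℝ)]
    exact this v' v (le_of_not_ge hle)
  have hpi := Real.pi_pos
  simp only [binAmplitude]
  by_cases hbin : bin m v = bin m v'
  · rw [hbin]
    split_ifs
    · exact bump_lipschitz hm hc _ _
    · simp; positivity
  · have hfl : ⌊(m : ℝ) * v⌋₊ < ⌊(m : ℝ) * v'⌋₊ := by
      refine lt_of_le_of_ne (Nat.floor_le_floor (by gcongr)) fun h => hbin (Fin.ext h)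
    -- The grid point `k / m` separates `v` from `v'` and is a zero of `bump`; each value is
    -- compared with that zero.
    set k := ⌊(m : ℝ) * v'⌋₊ with hk
    have h1 : (v : ℝ) ≤ k / m := by
      rw [le_div_iff₀ hm', mul_comm]
      exact (Nat.lt_of_floor_lt hfl).le
    have h2 : (k : ℝ) / m ≤ v' := by
      rw [div_le_iff₀ hm', mul_comm]
      exact Nat.floor_le (mul_nonneg hm'.le v'.2.1)
    have l1 := bump_lipschitz hm hc (v : ℝ) (k / m)
    have l2 := bump_lipschitz hm hc (v' : ℝ) (k / m)
    rw [bump_grid hm, sub_zero, abs_of_nonneg (bump_nonneg hc _)] at l1 l2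
    rw [abs_of_nonpos (by linarith)] at l1
    rw [abs_of_nonneg (by linarith)] at l2
    have hcp : 0 ≤ c * Real.pi := by positivity
    have p1 := mul_nonneg hcp (sub_nonneg.2 h1)
    have p2 := mul_nonneg hcp (sub_nonneg.2 h2)
    have n1 := bump_nonneg (m := m) hc (v : ℝ)
    have n2 := bump_nonneg (m := m) hc (v' : ℝ)
    rw [abs_of_nonpos (by linarith : (v : ℝ) - v' ≤ 0), abs_le]
    split_ifs <;> constructor <;> linarith

theorem lintegral_bump (hm : 0 < m) (hc : 0 ≤ c) :
    ∫⁻ v : unitInterval, ENNReal.ofReal (bump m c v) = ENNReal.ofReal (c / (2 * m)) := by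
  have hm' : (m : ℝ) ≠ 0 := by exact_mod_cast hm.ne'
  have hcont : Continuous (bump m c) := by unfold bump; fun_prop
  rw [unitInterval.measurePreserving_coe.lintegral_comp (f := fun x => ENNReal.ofReal (bump m c x))
    hcont.measurable.ennreal_ofReal, unitInterval, ← ofReal_integral_eq_lintegral_ofReal
    (hcont.integrableOn_Icc) (ae_of_all _ fun x => bump_nonneg hc x),
    integral_Icc_eq_integral_Ioc, ← intervalIntegral.integral_of_le zero_le_one]
  congr 1
  unfold bump
  simp_rw [← mul_assoc Real.pi]
  rw [intervalIntegral.integral_const_mul,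
    intervalIntegral.integral_comp_mul_left (fun x => Real.sin x ^ 2)
      (mul_ne_zero Real.pi_ne_zero hm'), integral_sin_sq]
  have : Real.sin (Real.pi * m * 1) = 0 := by
    rw [mul_one, mul_comm, Real.sin_nat_mul_pi]
  rw [this]
  have := Real.pi_ne_zero
  simp
  field_simp

/-- This fixes the number of bins: height squared times width is of order `m⁻³`, and `n ≤ m ^ 3` of
these add up to at most `4 * c ^ 2 ≤ 1 / 16`. -/
theorem one_add_pow_le {n : ℕ} (hm : 0 < m) (hc : 0 ≤ c) (hc' : c ≤ 1 / 8) (hn : n ≤ m ^ 3) :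
    (1 + ENNReal.ofReal (4 * (c / m) ^ 2) * ENNReal.ofReal (1 / m)) ^ n ≤ 5 / 4 := by
  have hm' : (0 : ℝ) < m := by exact_mod_cast hm
  have hn' : (n : ℝ) ≤ m ^ 3 := by exact_mod_cast hn
  set x : ℝ := 4 * (c / m) ^ 2 * (1 / m) with hx
  have hx0 : 0 ≤ x := by positivity
  have hnx : n * x ≤ 1 / 16 := by
    have : x = 4 * c ^ 2 / m ^ 3 := by rw [hx]; field_simp
    rw [this, ← mul_div_assoc, div_le_iff₀ (by positivity)]
    have : 4 * c ^ 2 ≤ 1 / 16 := by nlinarith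
    nlinarith [mul_le_mul hn' this (by positivity) (by positivity)]
  have hreal : (1 + x) ^ n ≤ 5 / 4 := by
    calc (1 + x) ^ n ≤ Real.exp x ^ n :=
          pow_le_pow_left₀ (by positivity) (by linarith [Real.add_one_le_exp x]) n
      _ = Real.exp (n * x) := (Real.exp_nat_mul x n).symm
      _ ≤ Real.exp (1 / 16) := Real.exp_le_exp.2 hnx
      _ ≤ 1 / (1 - 1 / 16) := Real.exp_bound_div_one_sub_of_interval (by norm_num) (by norm_num)
      _ ≤ 5 / 4 := by norm_num
  rw [← ENNReal.ofReal_mul (by positivity), ← ENNReal.ofReal_one,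
    ← ENNReal.ofReal_add zero_le_one hx0, ← ENNReal.ofReal_pow (by positivity)]
  refine (ENNReal.ofReal_le_ofReal hreal).trans_eq ?_
  rw [ENNReal.ofReal_div_of_pos (by norm_num)]
  simp

end bins

/-! ### Likelihood ratios and errors within the family. -/

variable {d K : ℕ} (e : Features d ≃ᵐ Latent K) (s₀ : Fin K) (M : ℝ)

theorem lintegral_law_tiltedModel (b : Amplitude) (hM : 0 < M) (w : Fin K → ℝ)
    {φ : Obs d K → ENNReal} (hφ : Measurable φ) :
    ∫⁻ o, φ o ∂(tiltedModel e s₀ M b hM w).law =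
      ∫⁻ z, ENNReal.ofReal (latentDensity s₀ b z.1 z.2) * φ (latentObs e s₀ M z)
        ∂(latentBase w) := by
  have hobs := measurable_latentObs e s₀ M
  have hden := measurable_latentDensity s₀ b
  rw [CausalModel.law, show (tiltedModel e s₀ M b hM w).featureLaw = tiltedFeatureLaw e s₀ b
    from rfl, show (tiltedModel e s₀ M b hM w).outcomeLaw = valueKernel e s₀ M from rfl,
    jointLaw_tilted, lintegral_map hφ hobs,
    lintegral_withDensity_eq_lintegral_mul _ hden.ennreal_ofReal (by fun_prop)]
  rfl

/-- All models push their latent laws forward by the same map `latentObs`, so a ratio of latent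
densities is a likelihood ratio of observations. -/
theorem law_tiltedModel_withDensity (b b' : Amplitude) (hM : 0 < M) (w : Fin K → ℝ)
    {g : Latent K → ℝ} (hg : Measurable g)
    (h : ∀ z, latentDensity s₀ b' z.1 z.2 = latentDensity s₀ b z.1 z.2 * g z) :
    (tiltedModel e s₀ M b' hM w).law =
      (tiltedModel e s₀ M b hM w).law.withDensity fun o => ENNReal.ofReal (g (o.1.1, (e o.1.2).2)) := by
  have he := e.measurable
  refine Measure.ext_of_lintegral _ fun φ hφ => ?_
  rw [lintegral_withDensity_eq_lintegral_mul _ (by fun_prop) hφ,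
    lintegral_law_tiltedModel e s₀ M b' hM w hφ,
    lintegral_law_tiltedModel e s₀ M b hM w (by fun_prop)]
  refine lintegral_congr fun z => ?_
  rw [h z, ENNReal.ofReal_mul (latentDensity_mem s₀ b _ _).1, mul_assoc]
  simp [latentObs]

theorem isProbabilityMeasure_law {w : Fin K → ℝ} (hw : ∀ s, 0 < w s) (hw1 : ∑ s, w s = 1)
    (P : CausalModel d K w) : IsProbabilityMeasure P.law := by
  have := isProbabilityMeasure_groupLaw hw hw1
  unfold CausalModel.law jointLaw
  infer_instance

theorem law_preimage_exogenous {w : Fin K → ℝ} (hw : ∀ s, 0 < w s) (hw1 : ∑ s, w s = 1)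
    (P : CausalModel d K w) {A : Set unitInterval} (hA : MeasurableSet A) :
    P.law {o | o.1.1.1 ∈ A} = volume A := by
  have := isProbabilityMeasure_groupLaw hw hw1
  have h : P.law.fst.fst.fst = volume := by
    rw [CausalModel.law, jointLaw, Measure.fst_compProd, Measure.fst_compProd, Measure.fst_prod]
  rw [← h, Measure.fst_apply hA, Measure.fst_apply (measurable_fst hA),
    Measure.fst_apply (measurable_fst (measurable_fst hA))]
  rfl

/-- The mean squared error at the latent description `z`, over an i.i.d. sample. -/
def latentError {n : ℕ} (b : Amplitude) (hM : 0 < M) (w : Fin K → ℝ) (est : Estimator d K n)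
    (ψ : Features d × Fin K → unitInterval) (f : Features d × Fin K → ℝ) (z : Latent K) : ENNReal :=
  ∫⁻ D, ENNReal.ofReal ((est.toFun ψ f D (e.symm z, z.1.2) - latentFair s₀ M b (w s₀) z) ^ 2)
    ∂(Measure.pi fun _ : Fin n => (tiltedModel e s₀ M b hM w).law)

theorem measurable_estimator_latent {n : ℕ} (est : Estimator d K n)
    (ψ : Features d × Fin K → unitInterval) (f : Features d × Fin K → ℝ) :
    Measurable fun q : (Fin n → Obs d K) × Latent K => est.toFun ψ f q.1 (e.symm q.2, q.2.1.2) := by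
  have he := e.symm.measurable
  exact (est.measurable_toFun ψ f).comp
    (f := fun q : (Fin n → Obs d K) × Latent K => (q.1, (e.symm q.2, q.2.1.2))) (by fun_prop)

/-- The mean squared error dominates the part of it in the groups that are not tilted. -/
theorem setLIntegral_latentError_le {n : ℕ} (b : Amplitude) (hM : 0 < M) {w : Fin K → ℝ}
    (hw : ∀ s, 0 < w s) (hw1 : ∑ s, w s = 1) (est : Estimator d K n) {B : Set (Latent K)}
    (hB : MeasurableSet B) (hBs : ∀ z ∈ B, z.1.2 ≠ s₀) :
    ∫⁻ z in B, latentError e s₀ M b hM w est (tiltedModel e s₀ M b hM w).abduct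
        (tiltedModel e s₀ M b hM w).bayes z ∂(latentBase w) ≤
      meanSquaredError (tiltedModel e s₀ M b hM w) est (tiltedFair e s₀ M b w) := by
  have := isProbabilityMeasure_law hw hw1 (tiltedModel e s₀ M b hM w)
  set ψ := (tiltedModel e s₀ M b hM w).abduct
  set f := (tiltedModel e s₀ M b hM w).bayes
  have hfair := measurable_latentFair s₀ M b (w s₀)
  have hm := measurable_estimator_latent e est ψ f
  have hF : Measurable fun q : (Fin n → Obs d K) × Latent K => ENNReal.ofReal
      ((est.toFun ψ f q.1 (e.symm q.2, q.2.1.2) - latentFair s₀ M b (w s₀) q.2) ^ 2) := by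
    fun_prop
  have : SFinite (latentBase w) := inferInstance
  unfold latentError meanSquaredError
  -- Swapping the integrals reduces the function-valued problem to estimating one number at each
  -- `z`.
  rw [lintegral_lintegral_swap (f := fun z D => ENNReal.ofReal
    ((est.toFun ψ f D (e.symm z, z.1.2) - latentFair s₀ M b (w s₀) z) ^ 2))
    (hF.comp measurable_swap).aemeasurable]
  refine lintegral_mono fun D => ?_
  have hpt : Measurable fun q => est.toFun ψ f D q :=
    (est.measurable_toFun ψ f).comp (measurable_prodMk_left (x := D))
  have hin := measurable_predictorInput (d := d) (K := K)
  have htf := measurable_tiltedFair e s₀ M b w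
  rw [lintegral_law_tiltedModel e s₀ M b hM w (by fun_prop)]
  refine le_trans ?_ (setLIntegral_le_lintegral B _)
  refine setLIntegral_mono' hB fun z hz => ?_
  -- Outside `s₀` every model has the same latent law, so errors of different models can be added
  -- under one measure.
  have hd : latentDensity s₀ b z.1 z.2 = 1 := by
    rw [latentDensity, if_neg (hBs z hz)]
  rw [hd, ENNReal.ofReal_one, one_mul]
  simp [latentObs, predictorInput, tiltedFair, ψ, f]

/-- The latent descriptions outside the group `s₀` at which an amplitude `β` matters. -/
def gapSet (β : unitInterval → ℝ) : Set (Latent K) :=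
  {z | z.1.2 ≠ s₀ ∧ 1 / 2 ≤ z.2 ∧ z.2 < 1 / 2 + β z.1.1}

theorem measurableSet_gapSet {β : unitInterval → ℝ} (hβ : Measurable β) :
    MeasurableSet (gapSet s₀ β) := by
  have h₁ : MeasurableSet {z : Latent K | z.1.2 ≠ s₀} :=
    ((measurableSet_singleton s₀).preimage (f := fun z : Latent K => z.1.2) (by fun_prop)).compl
  have h₂ : MeasurableSet {z : Latent K | 1 / 2 ≤ z.2} :=
    measurableSet_le measurable_const measurable_snd
  have h₃ : MeasurableSet {z : Latent K | z.2 < 1 / 2 + β z.1.1} :=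
    measurableSet_lt (by fun_prop) (by fun_prop)
  exact h₁.inter (h₂.inter h₃)

/-- Each slice outside `s₀` is an interval of length `β v`, and `β ≤ 1 / 2` keeps it inside `[0,
1)`. The mass is linear in the amplitude. -/
theorem latentBase_gapSet {w : Fin K → ℝ} (hw : ∀ s, 0 < w s) (hw1 : ∑ s, w s = 1)
    {β : unitInterval → ℝ} (hβ : Measurable β) (hβ1 : ∀ v, β v ≤ 1 / 2) :
    latentBase w (gapSet s₀ β) =
      (∫⁻ v, ENNReal.ofReal (β v)) * ENNReal.ofReal (1 - w s₀) := by
  have := isProbabilityMeasure_groupLaw hw hw1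
  have hslice : ∀ a : unitInterval × Fin K, unifLaw (Prod.mk a ⁻¹' gapSet s₀ β) =
      ENNReal.ofReal (β a.1) * ({s₀}ᶜ : Set (Fin K)).indicator (fun _ => 1) a.2 := by
    intro a
    by_cases hs : a.2 = s₀
    · have : Prod.mk a ⁻¹' gapSet s₀ β = ∅ := by ext r; simp [gapSet, hs]
      simp [this, hs]
    · have : Prod.mk a ⁻¹' gapSet s₀ β = Set.Ico (1 / 2) (1 / 2 + β a.1) := by
        ext r; simp [gapSet, hs]
      rw [this, unifLaw, Measure.restrict_apply measurableSet_Ico, Set.inter_eq_left.2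
        (Set.Ico_subset_Ico (by norm_num) (by linarith [hβ1 a.1])), Real.volume_Ico]
      simp [hs]
  have hsing : groupLaw w {s₀} = ENNReal.ofReal (w s₀) := by
    rw [groupLaw, Measure.sum_apply _ (measurableSet_singleton s₀), tsum_fintype,
      Finset.sum_eq_single s₀ (fun s _ hs => by simp [hs]) (by simp)]
    simp
  rw [latentBase, Measure.prod_apply (measurableSet_gapSet s₀ hβ)]
  simp_rw [hslice]
  rw [lintegral_prod_mul (f := fun v => ENNReal.ofReal (β v))
    (g := ({s₀}ᶜ : Set (Fin K)).indicator fun _ => 1) (by fun_prop)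
    (measurable_const.indicator (measurableSet_singleton s₀).compl).aemeasurable,
    lintegral_indicator_const (measurableSet_singleton s₀).compl, one_mul,
    prob_compl_eq_one_sub (measurableSet_singleton s₀), hsing,
    ENNReal.ofReal_sub _ (hw s₀).le, ENNReal.ofReal_one]

variable {m : ℕ} {c : ℝ}

/-- Turning the bump on bin `j` on and off cannot be detected from `n ≤ m ^ 3` observations. -/
theorem latentError_add_le {n : ℕ} (hm : 0 < m) (hc : 0 ≤ c) (hc' : c ≤ 1 / 8)
    (hn : n ≤ m ^ 3) (hM : 0 < M) {w : Fin K → ℝ} (hw : ∀ s, 0 < w s) (hw1 : ∑ s, w s = 1)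
    (est : Estimator d K n) (ψ : Features d × Fin K → unitInterval)
    (f : Features d × Fin K → ℝ) {z : Latent K} (hz : z ∈ gapSet s₀ fun v => bump m c v)
    (σ : Fin (m + 1) → Bool) :
    ENNReal.ofReal ((w s₀ * M) ^ 2 / 4) ≤
      latentError e s₀ M (binAmplitude hm hc hc' (Function.update σ (bin m z.1.1) false)) hM w
        est ψ f z +
      latentError e s₀ M (binAmplitude hm hc hc' (Function.update σ (bin m z.1.1) true)) hM w
        est ψ f z := by
  set j := bin m z.1.1 with hj
  set b₀ := binAmplitude hm hc hc' (Function.update σ j false) with hb₀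
  set b₁ := binAmplitude hm hc hc' (Function.update σ j true) with hb₁
  have hm' : (0 : ℝ) < m := by exact_mod_cast hm
  have he := e.measurable
  have e₀ : ∀ v, bin m v = j → b₀.toFun v = 0 := fun v hv => by
    simp [hb₀, binAmplitude, hv]
  have e₁ : ∀ v, bin m v = j → b₁.toFun v = bump m c v := fun v hv => by
    simp [hb₁, binAmplitude, hv]
  have e₂ : ∀ v, bin m v ≠ j → b₁.toFun v = b₀.toFun v := fun v hv => by
    simp [hb₀, hb₁, binAmplitude, Function.update_of_ne hv]
  -- The likelihood ratio: on bin `j` the first model is untilted, with density `1`; elsewhere the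
  -- two models agree.
  set g : Latent K → ℝ := fun y =>
    if bin m y.1.1 = j then latentDensity s₀ b₁ y.1 y.2 else 1 with hg
  have hset : MeasurableSet {v : unitInterval | bin m v = j} :=
    measurable_bin m (measurableSet_singleton j)
  have hgm : Measurable g := by
    have h := measurable_latentDensity s₀ b₁
    refine Measurable.ite ?_ h measurable_const
    exact hset.preimage (f := fun y : Latent K => y.1.1) (by fun_prop)
  have hden : ∀ y : Latent K, latentDensity s₀ b₁ y.1 y.2 =
      latentDensity s₀ b₀ y.1 y.2 * g y := by
    intro y
    by_cases hy : bin m y.1.1 = j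
    · simp [hg, hy, latentDensity, e₀ _ hy]
    · simp [hg, hy, latentDensity, e₂ _ hy]
  have hlaw := law_tiltedModel_withDensity e s₀ M b₀ b₁ hM w hgm hden
  have hp₀ := isProbabilityMeasure_law hw hw1 (tiltedModel e s₀ M b₀ hM w)
  have hp₁ := isProbabilityMeasure_law hw hw1 (tiltedModel e s₀ M b₁ hM w)
  have hgo : Measurable fun o : Obs d K => g (o.1.1, (e o.1.2).2) := by fun_prop
  have h1 : ∫⁻ o, ENNReal.ofReal (g (o.1.1, (e o.1.2).2)) ∂(tiltedModel e s₀ M b₀ hM w).law =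
      1 := by
    rw [← setLIntegral_univ, ← withDensity_apply _ MeasurableSet.univ, ← hlaw, measure_univ]
  have hg0 : ∀ y, 0 ≤ g y := fun y => by
    simp only [hg]
    split_ifs
    exacts [(latentDensity_mem s₀ b₁ _ _).1, zero_le_one]
  have hnear : ∀ o : Obs d K, (g (o.1.1, (e o.1.2).2) - 1) ^ 2 ≤
      {o : Obs d K | o.1.1.1 ∈ {v : unitInterval | bin m v = j}}.indicator
        (fun _ => 4 * (c / m) ^ 2) o := by
    intro o
    by_cases ho : bin m o.1.1.1 = j
    · rw [Set.indicator_of_mem (by exact ho)]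
      simp only [hg, ho, if_true, latentDensity, e₁ _ ho]
      split_ifs
      · rw [add_sub_cancel_left, mul_pow, ← sq_abs (tilt _), abs_tilt, one_pow, mul_one, mul_pow]
        have := pow_le_pow_left₀ (bump_nonneg (m := m) hc o.1.1.1) (bump_le hc _) 2
        linarith
      · rw [sub_self, zero_pow two_ne_zero]; positivity
    · rw [Set.indicator_of_notMem (by exact ho)]
      simp [hg, ho]
  have hsq := lintegral_sq_le_of_near_one hgo (fun o => hg0 _) h1
    (hset.preimage (f := fun o : Obs d K => o.1.1.1) (by fun_prop)) hnear
  have hS : (tiltedModel e s₀ M b₀ hM w).law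
      ((fun o : Obs d K => o.1.1.1) ⁻¹' {v | bin m v = j}) ≤ ENNReal.ofReal (1 / m) :=
    (law_preimage_exogenous hw hw1 _ hset).trans_le (volume_bin_le hm j)
  have hsq' := (hsq.trans (add_le_add_right (mul_le_mul_right hS _) 1))
  have h2 : (∫⁻ o, ENNReal.ofReal (g (o.1.1, (e o.1.2).2)) ^ 2
      ∂(tiltedModel e s₀ M b₀ hM w).law) ^ n ≤ 5 / 4 :=
    (pow_le_pow_left' hsq' n).trans (one_add_pow_le hm hc hc' hn)
  have htwo := two_point_bound_pi (n := n) hgo.ennreal_ofReal hlaw h2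
    (f := fun D => est.toFun ψ f D (e.symm z, z.1.2))
    ((est.measurable_toFun ψ f).comp (measurable_prodMk_right (y := (e.symm z, z.1.2))))
    (latentFair s₀ M b₀ (w s₀) z) (latentFair s₀ M b₁ (w s₀) z)
  refine le_trans (ENNReal.ofReal_le_ofReal ?_) htwo
  have := latentFair_gap s₀ M hM (hw s₀) b₀ b₁ hz.1 (e₀ _ rfl) hz.2.1
    (by rw [e₁ _ rfl]; exact hz.2.2)
  linarith

end FairRegression

/-! ### Assouad's averaging and the choice of constants. -/

namespace FairRegression

/-- If flipping any bit `j` of a hypothesis costs at least `κ` in total, so does half the average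
over all hypotheses. -/
theorem pow_mul_le_two_mul_sum {ι : Type*} [Fintype ι] [DecidableEq ι] (j : ι)
    (F : (ι → Bool) → ENNReal) {κ : ENNReal}
    (h : ∀ σ, κ ≤ F (Function.update σ j false) + F (Function.update σ j true)) :
    (2 : ENNReal) ^ Fintype.card ι * κ ≤ 2 * ∑ σ, F σ := by
  -- Flipping bit `j` permutes the hypotheses, so summing over pairs counts each hypothesis twice.
  have hinv : Function.Involutive fun σ : ι → Bool => Function.update σ j (!σ j) := by
    intro σ
    simp
  have hflip : ∑ σ, F (Function.update σ j (!σ j)) = ∑ σ, F σ :=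
    Equiv.sum_comp hinv.toPerm F
  have hpair : ∀ σ, κ ≤ F σ + F (Function.update σ j (!σ j)) := by
    intro σ
    have hσ : Function.update σ j (σ j) = σ := Function.update_eq_self j σ
    cases hj : σ j
    · have := h σ
      rw [hj] at hσ
      rwa [hσ] at this
    · have := h σ
      rw [hj] at hσ
      rwa [hσ, add_comm] at this
  calc (2 : ENNReal) ^ Fintype.card ι * κ = ∑ _σ : ι → Bool, κ := by simp
    _ ≤ ∑ σ, (F σ + F (Function.update σ j (!σ j))) := Finset.sum_le_sum fun σ _ => hpair σ
    _ = 2 * ∑ σ, F σ := by rw [Finset.sum_add_distrib, hflip, two_mul]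

variable {d K : ℕ} (e : Features d ≃ᵐ Latent K) (s₀ : Fin K) {M : ℝ} {m : ℕ} {c : ℝ}

theorem measurable_latentError {n : ℕ} (b : Amplitude) (hM : 0 < M) {w : Fin K → ℝ}
    (hw : ∀ s, 0 < w s) (hw1 : ∑ s, w s = 1) (est : Estimator d K n)
    (ψ : Features d × Fin K → unitInterval) (f : Features d × Fin K → ℝ) :
    Measurable (latentError e s₀ M b hM w est ψ f) := by
  have := isProbabilityMeasure_law hw hw1 (tiltedModel e s₀ M b hM w)
  have hfair := measurable_latentFair s₀ M b (w s₀)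
  have hm := measurable_estimator_latent e est ψ f
  have hF : Measurable fun q : (Fin n → Obs d K) × Latent K => ENNReal.ofReal
      ((est.toFun ψ f q.1 (e.symm q.2, q.2.1.2) - latentFair s₀ M b (w s₀) q.2) ^ 2) := by
    fun_prop
  exact hF.lintegral_prod_left'

/-- Assouad's argument: an upper bound on the mean squared error over all bump hypotheses
dominates the size of the bumps. -/
theorem le_of_forall_meanSquaredError_le {n : ℕ} (hm : 0 < m) (hc : 0 ≤ c) (hc' : c ≤ 1 / 8)
    (hn : n ≤ m ^ 3) (hM : 0 < M) {w : Fin K → ℝ} (hw : ∀ s, 0 < w s) (hw1 : ∑ s, w s = 1)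
    (est : Estimator d K n) {R : ENNReal}
    (hR : ∀ σ, meanSquaredError (tiltedModel e s₀ M (binAmplitude hm hc hc' σ) hM w) est
      (tiltedFair e s₀ M (binAmplitude hm hc hc' σ) w) ≤ R) :
    ENNReal.ofReal ((w s₀ * M) ^ 2 * (1 - w s₀) * c / (16 * m)) ≤ R := by
  have hm' : (0 : ℝ) < m := by exact_mod_cast hm
  have hbm : Measurable fun v : unitInterval => bump m c v := by unfold bump; fun_prop
  set B : Set (Latent K) := gapSet s₀ fun v => bump m c v with hB
  have hBm : MeasurableSet B := measurableSet_gapSet s₀ hbm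
  -- These functions do not depend on `σ`, so the estimator is the same function of the sample under
  -- all hypotheses.
  set ψ : Features d × Fin K → unitInterval := fun q => (e q.1).1.1
  set f : Features d × Fin K → ℝ := fun q => latentValue s₀ M (e q.1)
  set E : (Fin (m + 1) → Bool) → Latent K → ENNReal := fun σ =>
    latentError e s₀ M (binAmplitude hm hc hc' σ) hM w est ψ f with hE
  have hEm : ∀ σ, Measurable (E σ) := fun σ => measurable_latentError e s₀ _ hM hw hw1 est ψ f
  have hER : ∀ σ, ∫⁻ z in B, E σ z ∂(latentBase w) ≤ R := fun σ =>
    (setLIntegral_latentError_le e s₀ M (binAmplitude hm hc hc' σ) hM hw hw1 est hBm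
      fun z hz => hz.1).trans (hR σ)
  set κ := ENNReal.ofReal ((w s₀ * M) ^ 2 / 4) with hκ
  -- The bit flipped is that of the bin containing `z`, but the bound does not depend on `z` and can
  -- be integrated over `B`.
  have hpt : ∀ z ∈ B, (2 : ENNReal) ^ (m + 1) * κ ≤ 2 * ∑ σ, E σ z := by
    intro z hz
    have := pow_mul_le_two_mul_sum (bin m z.1.1) (fun σ => E σ z) fun σ =>
      latentError_add_le e s₀ M hm hc hc' hn hM hw hw1 est ψ f hz σ
    rwa [Fintype.card_fin] at this
  have hmain : (2 : ENNReal) ^ (m + 1) * (κ * latentBase w B) ≤ 2 ^ (m + 1) * (2 * R) := by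
    calc (2 : ENNReal) ^ (m + 1) * (κ * latentBase w B)
        = ∫⁻ _ in B, (2 : ENNReal) ^ (m + 1) * κ ∂(latentBase w) := by
          rw [setLIntegral_const, mul_assoc]
      _ ≤ ∫⁻ z in B, 2 * ∑ σ, E σ z ∂(latentBase w) := setLIntegral_mono' hBm hpt
      _ = 2 * ∑ σ, ∫⁻ z in B, E σ z ∂(latentBase w) := by
          rw [lintegral_const_mul _ (Finset.measurable_fun_sum _ fun σ _ => hEm σ),
            lintegral_finsetSum _ fun σ _ => hEm σ]
      _ ≤ 2 * ∑ _σ : Fin (m + 1) → Bool, R := by gcongr with σ; exact hER σ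
      _ = 2 ^ (m + 1) * (2 * R) := by simp; ring
  have hmain' : κ * latentBase w B ≤ 2 * R :=
    (ENNReal.mul_le_mul_iff_right (by simp) (by simp)).1 hmain
  rw [hB, latentBase_gapSet s₀ hw hw1 hbm
    (fun v => (bump_le_const hm hc v).trans (by linarith)), lintegral_bump hm hc, hκ,
    ← ENNReal.ofReal_mul (by positivity), ← ENNReal.ofReal_mul (by positivity)] at hmain'
  -- The `16` collects `4` from the two-point bound, `2` from the mean of `sin ^ 2` and `2` from the
  -- pairing.
  have h2 : (2 : ENNReal) * ENNReal.ofReal ((w s₀ * M) ^ 2 * (1 - w s₀) * c / (16 * m)) ≤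
      2 * R := by
    refine le_trans (le_of_eq ?_) hmain'
    rw [show (2 : ENNReal) = ENNReal.ofReal 2 by simp, ← ENNReal.ofReal_mul (by norm_num)]
    congr 1
    field_simp
    ring
  exact (ENNReal.mul_le_mul_iff_right (by simp) (by simp)).1 h2

/-- A number of bins of the order of the cube root of `n`. -/
theorem exists_bin_count {n : ℕ} (hn : 1 ≤ n) :
    ∃ m : ℕ, 0 < m ∧ n ≤ m ^ 3 ∧ (n : ℝ) ^ (-(1 / 3) : ℝ) ≤ 2 / m := by
  have hn' : (1 : ℝ) ≤ n := by exact_mod_cast hn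
  set t : ℝ := (n : ℝ) ^ (1 / 3 : ℝ) with ht
  have ht1 : 1 ≤ t := Real.one_le_rpow hn' (by norm_num)
  have ht3 : t ^ 3 = n := by
    rw [ht, ← Real.rpow_natCast, ← Real.rpow_mul (by positivity)]
    norm_num
  have hm : 0 < ⌈t⌉₊ := Nat.ceil_pos.2 (by linarith)
  -- Rounding up secures `n ≤ m ^ 3`; since `t ≥ 1`, it costs at most a factor `2`.
  refine ⟨⌈t⌉₊, hm, ?_, ?_⟩
  · have : (n : ℝ) ≤ (⌈t⌉₊ : ℝ) ^ 3 := by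
      rw [← ht3]
      exact pow_le_pow_left₀ (by positivity) (Nat.le_ceil t) 3
    exact_mod_cast this
  · have hm' : (0 : ℝ) < ⌈t⌉₊ := by exact_mod_cast hm
    rw [Real.rpow_neg (by positivity), ← ht, inv_eq_one_div, div_le_div_iff₀ (by positivity) hm']
    linarith [Nat.ceil_lt_add_one (show 0 ≤ t by positivity)]

end FairRegression

end

theorem theorem3 (M L : ℝ) (hM : 0 < M) (hL : 0 < L) (K : ℕ) (hK : 2 ≤ K) (w : Fin K → ℝ)
    (hw : ∀ s, 0 < w s) (hw1 : ∑ s, w s = 1) :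
    ∃ C : ℝ, 0 < C ∧ ∀ d n : ℕ, 1 ≤ d → 1 ≤ n →
      ENNReal.ofReal (C * (n : ℝ) ^ (-(1 / 3) : ℝ)) ≤
        ⨅ est : FairRegression.Estimator d K n,
          ⨆ (P : FairRegression.CausalModel d K w) (_ : P.InClass M L)
            (f₀ : FairRegression.Features d × Fin K → ℝ) (_ : P.IsOptimalFair f₀),
            FairRegression.meanSquaredError P est f₀ := by
  open FairRegression in
  let s₀ : Fin K := ⟨0, by omega⟩
  -- The error is measured in the groups other than `s₀`; a second group gives them positive weight.
  have hw₀ : w s₀ < 1 := by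
    let s₁ : Fin K := ⟨1, by omega⟩
    have hne : s₀ ≠ s₁ := by simp [s₀, s₁, Fin.ext_iff]
    have := Finset.sum_le_sum_of_subset_of_nonneg (Finset.subset_univ {s₀, s₁})
      fun s _ _ => (hw s).le
    rw [Finset.sum_pair hne, hw1] at this
    linarith [hw s₁]
  have hα := hw s₀
  have hβ : 0 < 1 - w s₀ := by linarith
  have hpi := Real.pi_pos
  -- The first bound gives the Lipschitz constant `L` (the bumps have slope at most `c * π`, the
  -- density doubles it); the second keeps amplitudes below `1 / 8`.
  set c : ℝ := min (L / (2 * Real.pi)) (1 / 8) with hcdef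
  have hc : 0 < c := lt_min (by positivity) (by norm_num)
  have hc' : c ≤ 1 / 8 := min_le_right _ _
  have hcL : 2 * (c * Real.pi) ≤ L := by
    have := min_le_left (L / (2 * Real.pi)) (1 / 8)
    rw [le_div_iff₀ (by positivity)] at this
    linarith
  refine ⟨(w s₀ * M) ^ 2 * (1 - w s₀) * c / 32, by positivity, fun d n hd hn => ?_⟩
  obtain ⟨e⟩ := nonempty_encoding hd (by omega : 0 < K)
  obtain ⟨m, hm, hnm, hrate⟩ := exists_bin_count hn
  refine le_iInf fun est => ?_
  refine le_trans (ENNReal.ofReal_le_ofReal ?_)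
    (le_of_forall_meanSquaredError_le e s₀ hm hc.le hc' hnm hM hw hw1 est fun σ => ?_)
  · have hm' : (0 : ℝ) < m := by exact_mod_cast hm
    refine (mul_le_mul_of_nonneg_left hrate (by positivity)).trans (le_of_eq ?_)
    field_simp
    norm_num
  · refine le_iSup₂_of_le (tiltedModel e s₀ M (binAmplitude hm hc.le hc' σ) hM w) ?_
      (le_iSup₂_of_le _ (isOptimalFair_tiltedFair e s₀ M _ hM hw hw1 hw₀) le_rfl)
    refine inClass_tiltedModel e s₀ M _ hM w fun v v' => ?_
    have h := binAmplitude_lipschitz hm hc.le hc' σ v v'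
    have := mul_le_mul_of_nonneg_right hcL (abs_nonneg ((v : ℝ) - v'))
    linarith
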